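/- Let $\mathcal H=(\mathbb C^2)^{\otimes N}$, of dimension $d=2^N$. For $0\le Q\le N$ let $P_Q$ be the orthogonal projector onto the span of the computational basis states of Hamming weight $Q$, let $d_Q=\binom NQ$ be its rank, and let $\rho_Q=P_Q/d_Q$. There is an absolute constant $C$ such that for all integers $N,k\ge 0$, $0\le Q\le N$ and $1\le r\le d_Q$, and every orthogonal projector $\Pi_r$ of rank $r$ on $\mathcal H$, the following holds. Let $U$ be distributed according to the Haar probability measure on the unitary group of $\mathcal H$. Then $\operatorname{Tr}(P_QU\Pi_rU^\dagger P_Q)\neq 0$ almost surely, so that the normalized state $$\rho_U=\frac{P_QU\Pi_rU^\dagger P_Q}{\operatorname{Tr}(P_QU\Pi_rU^\dagger P_Q)}$$ is almost surely defined; the matrix entries of $\rho_U^{\otimes k}$ are integrable; and $$\left\Vert \mathbb E_U\,\rho_U^{\otimes k}-\rho_Q^{\otimes k}\right\Vert_{\rm tr}\le C\,\frac{k^2}{r},$$ where $\Vert A\Vert_{\rm tr}=\operatorname{Tr}\sqrt{A^\dagger A}$. In particular, the bound $O(k^2/r)$ holds as $N\to\infty$ whenever $r=e^{o(N)}$ and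 $|Q-N/2|\le O(\sqrt N)$, for then $r\le d_Q$ for all large $N$. -/

import Mathlib

open MeasureTheory

namespace HaarCharge

/-! ### Haar measure on the unitary group -/

section Haar

variable (n : Type*) [Fintype n] [DecidableEq n]

/-- The unitary group carries its Borel sigma-algebra. -/
noncomputable instance instMeasurableSpaceUnitary : MeasurableSpace (Matrix.unitaryGroup n ℂ) := borel _

instance instBorelSpaceUnitary : BorelSpace (Matrix.unitaryGroup n ℂ) := ⟨rfl⟩

/-- The unitary group is compact: it is closed, and its entries have modulus at most one. -/
instance instCompactSpaceUnitary : CompactSpace (Matrix.unitaryGroup n ℂ) := by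
  refine isCompact_iff_compactSpace.mp (?_ : IsCompact (Matrix.unitaryGroup n ℂ : Set (Matrix n n ℂ)))
  have hK : IsCompact
      (Set.pi Set.univ fun _ : n => Set.pi Set.univ fun _ : n => Metric.closedBall (0 : ℂ) 1) :=
    isCompact_univ_pi fun _ => isCompact_univ_pi fun _ => isCompact_closedBall _ _
  have hc : IsClosed {U : Matrix n n ℂ | U * star U = 1} :=
    isClosed_eq (by fun_prop) continuous_const
  have he : (Matrix.unitaryGroup n ℂ : Set (Matrix n n ℂ)) = {U | U * star U = 1} := by
    ext U
    exact Matrix.mem_unitaryGroup_iff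
  refine IsCompact.of_isClosed_subset hK (he ▸ hc) ?_
  intro U hU i _ j _
  simpa using entry_norm_bound_of_unitary hU i j

/-- The Haar probability measure on the unitary group: the Haar measure that gives the whole
(compact) group mass one. -/
noncomputable def haarUnitary : Measure (Matrix.unitaryGroup n ℂ) :=
  Measure.haarMeasure ⊤

theorem haarUnitary_univ : haarUnitary n Set.univ = 1 := by
  have h := Measure.haarMeasure_self
    (K₀ := (⊤ : TopologicalSpace.PositiveCompacts (Matrix.unitaryGroup n ℂ)))
  simpa [haarUnitary] using h

instance instIsProbabilityMeasureHaar : IsProbabilityMeasure (haarUnitary n) :=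
  ⟨haarUnitary_univ n⟩

end Haar

/-! ### Matrices -/

section Matrices

variable {n : Type*} [Fintype n] [DecidableEq n]

/-- The trace norm `Tr √(Aᴴ A)`, that is, the sum of the singular values of `A`. -/
noncomputable def traceNorm (A : Matrix n n ℂ) : ℝ :=
  ∑ i, √((Matrix.isHermitian_conjTranspose_mul_self A).eigenvalues i)

/-- The `k`-fold tensor (Kronecker) power `A ⊗ ⋯ ⊗ A`, in the product basis. -/
def tensorPow (k : ℕ) (A : Matrix n n ℂ) : Matrix (Fin k → n) (Fin k → n) ℂ :=
  Matrix.of fun a b => ∏ j, A (a j) (b j)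

end Matrices

/-! ### Qubits and charge sectors -/

/-- The computational basis of `N` qubits: bit strings of length `N`. -/
abbrev Basis (N : ℕ) : Type := Fin N → Fin 2

/-- The charge (Hamming weight) of a bit string. -/
def charge {N : ℕ} (s : Basis N) : ℕ := ∑ i, (s i : ℕ)

/-- `P_Q`, the orthogonal projector onto the span of the basis states of charge `Q`. -/
def chargeProj (N Q : ℕ) : Matrix (Basis N) (Basis N) ℂ :=
  Matrix.diagonal fun s => if charge s = Q then 1 else 0

/-- `d_Q = N.choose Q`, the dimension of the sector of charge `Q`. -/
def sectorDim (N Q : ℕ) : ℕ := N.choose Q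

/-- `ρ_Q = P_Q / d_Q`, the maximally mixed state of the sector of charge `Q`. -/
noncomputable def sectorState (N Q : ℕ) : Matrix (Basis N) (Basis N) ℂ :=
  (sectorDim N Q : ℂ)⁻¹ • chargeProj N Q

/-- The unnormalized state `P_Q U Π U† P_Q`. -/
noncomputable def projectedOp {N : ℕ} (Q : ℕ) (P : Matrix (Basis N) (Basis N) ℂ)
    (U : Matrix.unitaryGroup (Basis N) ℂ) : Matrix (Basis N) (Basis N) ℂ :=
  chargeProj N Q * (U : Matrix (Basis N) (Basis N) ℂ) * P
    * (U : Matrix (Basis N) (Basis N) ℂ).conjTranspose * chargeProj N Q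

/-- The normalized state `P_Q U Π U† P_Q / Tr(P_Q U Π U† P_Q)`. -/
noncomputable def projectedState {N : ℕ} (Q : ℕ) (P : Matrix (Basis N) (Basis N) ℂ)
    (U : Matrix.unitaryGroup (Basis N) ℂ) : Matrix (Basis N) (Basis N) ℂ :=
  (projectedOp Q P U).trace⁻¹ • projectedOp Q P U

/-- The `k`-copy average `E_U ρ_U^{⊗k}` over Haar-random `U`, as an entrywise integral. -/
noncomputable def averagedCopies {N : ℕ} (Q : ℕ) (P : Matrix (Basis N) (Basis N) ℂ) (k : ℕ) :
    Matrix (Fin k → Basis N) (Fin k → Basis N) ℂ :=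
  Matrix.of fun a b => ∫ U, tensorPow k (projectedState Q P U) a b ∂(haarUnitary (Basis N))

end HaarCharge

/-!
Write `ρ_U` for the normalized compression of `U Π U†` to the charge sector `S`, of dimension
`m = d_Q`, and put `d = 2 ^ N`. The bound splits into a statement about a single state supported in
the sector and an estimate of the mean purity `E Tr ρ_U²`.

*Duality and symmetry.* The difference `E ρ_U^{⊗k} - ρ_Q^{⊗k}` is Hermitian, so its trace norm is
`Tr (W · (E ρ_U^{⊗k} - ρ_Q^{⊗k}))` for the unitary `W` obtained from it by applying the sign
function (`exists_unitary_traceNorm_eq`). By left invariance of Haar measure the difference commutes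
with `V^{⊗k}` for every unitary `V` commuting with `P_Q`, and hence so does `W`. Neither a twirl of
`W` nor Schur-Weyl duality is needed.

*One state.* Let `ρ` be a state supported in `S`. A unitary commuting with `P_Q` diagonalizes it,
and as `W` commutes with the tensor powers of this unitary,
`Tr (W ρ^{⊗k}) = ∑ W_aa p_{a₁} ⋯ p_{a_k}`
where `p` lists the eigenvalues of `ρ`. Permutations of the basis of `S` commute with `P_Q` as well,
so `W_aa` takes one value `w` on all tuples `a` of distinct elements of `S`. The tuples with a
repetition have total weight at most `k² ∑ p² = k² Tr ρ²` (the birthday bound), whence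
`|Tr (W ρ^{⊗k}) - w| ≤ 2 k² Tr ρ²` with `w` independent of `ρ`
(`exists_norm_trace_mul_tensorPow_sub_le`). This applies to `ρ_Q`, of purity `1 / m ≤ 1 / r`, and to
almost every `ρ_U`.

*Mean purity.* For `A = U Π U†` the purity of `ρ_U` is `F / T²` with `T = ∑_{s ∈ S} A_ss` and
`F = ∑_{s,t ∈ S} |A_st|²`. For `s ≠ t`, the moments `E A_ss²`, `E |A_st|²` and `E A_ss A_tt` are
determined by `A² = A`, `Tr A = r`, permutation invariance, and the relation
`E A_ss² = E |A_st|² + E A_ss A_tt` that comes from rotating `e_s` to `(e_s + ω e_t) / √2`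
(`exists_second_moments`). They give `E (T - μ)² ≤ m r / d²` for `μ = E T = m r / d`, and
`E F ≤ m r (m + r) / d²`. Since `F ≤ T²`, a Chebyshev-type argument yields `E (F / T²) ≤ 12 / r`
(`integral_purity_le`).

*Non-degeneracy.* `T = 0` forces `A_ss = 0` for `s ∈ S`. By invariance the probability of `A_ss = 0`
equals that of `⟨v, A v⟩ = 0` for each unit vector `v`. Taking `v` along the points of the moment
curve, at most `d` of these events can occur at once, while there are infinitely many of them, so
the probability is zero (`ae_conjugate_diag_ne_zero`).
-/

namespace HaarCharge

/-! ### Tensor powers, the trace norm and unitary matrices -/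

section Algebra

variable {n : Type*}

theorem tensorPow_mul [Fintype n] (k : ℕ) (A B : Matrix n n ℂ) :
    tensorPow k (A * B) = tensorPow k A * tensorPow k B := by
  ext a b
  simp only [tensorPow, Matrix.of_apply, Matrix.mul_apply, Finset.prod_univ_sum,
    Fintype.piFinset_univ, Finset.prod_mul_distrib]

theorem tensorPow_conjTranspose (k : ℕ) (A : Matrix n n ℂ) :
    tensorPow k A.conjTranspose = (tensorPow k A).conjTranspose := by
  ext a b
  simp [tensorPow, Matrix.conjTranspose_apply]

theorem tensorPow_one [DecidableEq n] (k : ℕ) : tensorPow k (1 : Matrix n n ℂ) = 1 := by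
  ext a b
  simp only [tensorPow, Matrix.of_apply, Matrix.one_apply]
  rw [Finset.prod_ite_zero]
  simp [funext_iff]

theorem tensorPow_diagonal [DecidableEq n] (k : ℕ) (p : n → ℂ) :
    tensorPow k (Matrix.diagonal p) = Matrix.diagonal fun a => ∏ j, p (a j) := by
  ext a b
  simp only [tensorPow, Matrix.of_apply, Matrix.diagonal_apply]
  rw [Finset.prod_ite_zero]
  simp [funext_iff]

/-- Both sides are the sum of the square roots of the eigenvalues of `Aᴴ A = A²`. -/
theorem traceNorm_eq_trace_abs [Fintype n] [DecidableEq n] {A : Matrix n n ℂ} (hA : A.IsHermitian) :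
    (traceNorm A : ℂ) = (cfc (fun x : ℝ => |x|) A).trace := by
  have hB := Matrix.isHermitian_conjTranspose_mul_self A
  have h1 : cfc (fun x : ℝ => |x|) A = cfc Real.sqrt (A.conjTranspose * A) := by
    have hsq : A.conjTranspose * A = cfc (fun x : ℝ => x ^ 2) A := by
      rw [cfc_pow_id (R := ℝ) A 2 hA.isSelfAdjoint, hA.eq, sq]
    rw [hsq, ← cfc_comp' Real.sqrt (fun x : ℝ => x ^ 2) A (by fun_prop) (by fun_prop)
      hA.isSelfAdjoint]
    simp only [Real.sqrt_sq_eq_abs]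
  rw [h1, hB.cfc_eq, Matrix.IsHermitian.cfc, Unitary.conjStarAlgAut_apply, Matrix.trace_mul_comm,
    ← mul_assoc]
  simp [traceNorm, Matrix.trace_diagonal]

/-- The trace norm of a Hermitian matrix is attained on a unitary, the sign of `A` (with the sign
of `0` taken to be `1`), which commutes with everything that commutes with `A`. -/
theorem exists_unitary_traceNorm_eq [Fintype n] [DecidableEq n] {A : Matrix n n ℂ}
    (hA : A.IsHermitian) :
    ∃ W ∈ Matrix.unitaryGroup n ℂ, (∀ B, Commute A B → Commute W B) ∧
      (traceNorm A : ℂ) = (W * A).trace := by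
  have hfin : (spectrum ℝ A).Finite := Matrix.finite_real_spectrum
  let f : ℝ → ℝ := fun x => if 0 ≤ x then 1 else -1
  have hf : ContinuousOn f (spectrum ℝ A) := hfin.continuousOn f
  refine ⟨cfc f A, ?_, fun B hB => ?_, ?_⟩
  · rw [Matrix.mem_unitaryGroup_iff', ← cfc_star, ← cfc_mul _ _ A (by simpa using hf) hf]
    have : (fun x => star (f x) * f x) = fun _ => 1 := by
      ext x; simp only [f]; split_ifs <;> simp
    rw [this, cfc_const_one ℝ A hA.isSelfAdjoint]
  · exact hA.isSelfAdjoint.commute_cfc hB f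
  · rw [traceNorm_eq_trace_abs hA]
    have : cfc f A * A = cfc (fun x => f x * x) A := by
      rw [cfc_mul f (fun x => x) A hf (by fun_prop), cfc_id' ℝ A hA.isSelfAdjoint]
    rw [this]
    congr 2
    ext x
    simp only [f]
    split_ifs with h
    · simp [abs_of_nonneg h]
    · simp [abs_of_neg (not_le.mp h)]

/-- Every unit vector is a row of some unitary matrix. -/
theorem exists_unitary_row [Fintype n] [DecidableEq n] (s : n) (v : n → ℂ)
    (hv : ∑ i, ‖v i‖ ^ 2 = 1) :
    ∃ V : Matrix.unitaryGroup n ℂ, (V : Matrix n n ℂ) s = v := by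
  let w : EuclideanSpace ℂ n := WithLp.toLp 2 fun i => star (v i)
  have hw : ‖w‖ = 1 := by
    rw [EuclideanSpace.norm_eq]
    simp [w, hv]
  obtain ⟨b, hb⟩ := Orthonormal.exists_orthonormalBasis_extension_of_card_eq (𝕜 := ℂ)
    (E := EuclideanSpace ℂ n) (ι := n) (by simp) (v := fun _ => w) (s := {s}) (by
      rw [orthonormal_iff_ite]
      rintro ⟨i, hi⟩ ⟨j, hj⟩
      simp only [Set.mem_singleton_iff] at hi hj
      subst hi; subst hj
      simp [inner_self_eq_norm_sq_to_K, hw])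
  refine ⟨⟨Matrix.of fun i j => star (b i j), ?_⟩, ?_⟩
  · rw [Matrix.mem_unitaryGroup_iff]
    ext i j
    have := orthonormal_iff_ite.mp b.orthonormal i j
    rw [Matrix.one_apply]
    simp only [EuclideanSpace.inner_eq_star_dotProduct, dotProduct] at this
    simp only [Matrix.mul_apply, Matrix.star_apply, Matrix.of_apply, star_star]
    simpa [mul_comm] using this
  · ext i
    simp [hb s rfl, w]

theorem permMatrix_mem_unitaryGroup [Fintype n] [DecidableEq n] (σ : Equiv.Perm n) :
    σ.permMatrix ℂ ∈ Matrix.unitaryGroup n ℂ := by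
  rw [Matrix.mem_unitaryGroup_iff, Matrix.star_eq_conjTranspose, Matrix.conjTranspose_permMatrix,
    ← Matrix.permMatrix_mul]
  simp

theorem trace_eq_rank_of_isStarProjection [Fintype n] [DecidableEq n] {P : Matrix n n ℂ}
    (hP : IsStarProjection P) :
    P.trace = P.rank := by
  have h := LinearMap.IsIdempotentElem.isProj_range (f := Matrix.toLin' P)
    (hP.isIdempotentElem.map (Matrix.toLinAlgEquiv' (R := ℂ)))
  have := h.trace
  rw [Matrix.trace_toLin'_eq] at this
  rw [this]
  rfl

end Algebra

/-! ### Operators commuting with the unitaries of a sector -/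

section Twirl

open scoped ComplexOrder

/-- For independent samples with distribution `p`, the probability that samples `a` and `b`
coincide is `∑ p²`. -/
theorem sum_prod_of_eq_le_sum_sq {n : Type*} [Fintype n] [DecidableEq n] {k : ℕ} {p : n → ℝ}
    (hp1 : ∑ x, p x = 1) {a b : Fin k} (hab : a ≠ b) :
    ∑ i : Fin k → n, (if i a = i b then ∏ j, p (i j) else 0) = ∑ x, p x ^ 2 := by
  -- Splitting over the common value `x` turns the indicator of `i a = i b` into a product over `j`.
  have key : ∀ i : Fin k → n, (if i a = i b then ∏ j, p (i j) else 0)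
      = ∑ x, ∏ j, (p (i j) * if (j = a ∨ j = b) ∧ i j ≠ x then 0 else 1) := by
    intro i
    have : ∀ x, ∏ j, (p (i j) * if (j = a ∨ j = b) ∧ i j ≠ x then 0 else 1)
        = if i a = x then (if i a = i b then ∏ j, p (i j) else 0) else 0 := by
      intro x
      by_cases h : i a = x
      · by_cases h' : i a = i b
        · rw [if_pos h, if_pos h']
          refine Finset.prod_congr rfl fun j _ => ?_
          rw [if_neg, mul_one]
          rintro ⟨rfl | rfl, h2⟩
          · exact h2 h
          · exact h2 (h' ▸ h)
        · rw [if_pos h, if_neg h']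
          refine Finset.prod_eq_zero (Finset.mem_univ b) ?_
          rw [if_pos ⟨Or.inr rfl, fun h2 => h' (h.trans h2.symm)⟩, mul_zero]
      · rw [if_neg h]
        refine Finset.prod_eq_zero (Finset.mem_univ a) ?_
        rw [if_pos ⟨Or.inl rfl, h⟩, mul_zero]
    simp only [this, Finset.sum_ite_eq, Finset.mem_univ, if_true]
  rw [Finset.sum_congr rfl fun i _ => key i, Finset.sum_comm]
  refine Finset.sum_congr rfl fun x _ => ?_
  have := Finset.prod_univ_sum (fun _ : Fin k => (Finset.univ : Finset n))
    (fun j y => p y * if (j = a ∨ j = b) ∧ y ≠ x then 0 else 1)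
  rw [Fintype.piFinset_univ] at this
  rw [← this]
  have h2 : ∀ j, ∑ y, (p y * if (j = a ∨ j = b) ∧ y ≠ x then 0 else 1)
      = if j = a ∨ j = b then p x else 1 := by
    intro j
    by_cases hj : j = a ∨ j = b
    · simp [hj, ite_not]
    · simp [hj, hp1]
  rw [Finset.prod_congr rfl fun j _ => h2 j, Finset.prod_ite, Finset.prod_const_one, mul_one,
    Finset.prod_const]
  congr 1
  rw [Finset.filter_or, Finset.filter_eq', Finset.filter_eq']
  simp only [Finset.mem_univ, if_true]
  exact Finset.card_pair hab

/-- The birthday bound: the probability that `k` independent samples with distribution `p` are not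
pairwise distinct is at most `k² ∑ p²`. -/
theorem sum_prod_not_injective_le {n : Type*} [Fintype n] [DecidableEq n] (k : ℕ) {p : n → ℝ}
    (hp : ∀ x, 0 ≤ p x) (hp1 : ∑ x, p x = 1) :
    ∑ i : Fin k → n, (if Function.Injective i then 0 else ∏ j, p (i j))
      ≤ (k : ℝ) ^ 2 * ∑ x, p x ^ 2 := by
  have hprod : ∀ i : Fin k → n, 0 ≤ ∏ j, p (i j) := fun i => Finset.prod_nonneg fun j _ => hp _
  have h1 : ∀ i : Fin k → n, (if Function.Injective i then 0 else ∏ j, p (i j))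
      ≤ ∑ a, ∑ b, if a ≠ b then (if i a = i b then ∏ j, p (i j) else 0) else 0 := by
    intro i
    have hnn : ∀ a b, 0 ≤ if a ≠ b then (if i a = i b then ∏ j, p (i j) else 0) else 0 := by
      intro a b
      split_ifs <;> simp [hprod]
    split_ifs with h
    · exact Finset.sum_nonneg fun a _ => Finset.sum_nonneg fun b _ => hnn a b
    · simp only [Function.Injective, not_forall] at h
      obtain ⟨a, b, hab, hne⟩ := h
      calc ∏ j, p (i j) = if a ≠ b then (if i a = i b then ∏ j, p (i j) else 0) else 0 := by
            rw [if_pos hne, if_pos hab]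
        _ ≤ ∑ b, if a ≠ b then (if i a = i b then ∏ j, p (i j) else 0) else 0 :=
            Finset.single_le_sum (fun b _ => hnn a b) (Finset.mem_univ b)
        _ ≤ _ := Finset.single_le_sum
            (f := fun a => ∑ b, if a ≠ b then (if i a = i b then ∏ j, p (i j) else 0) else 0)
            (fun a _ => Finset.sum_nonneg fun b _ => hnn a b) (Finset.mem_univ a)
  refine (Finset.sum_le_sum fun i _ => h1 i).trans ?_
  rw [Finset.sum_comm]
  have h2 : ∀ a : Fin k, ∑ i : Fin k → n, ∑ b,
      (if a ≠ b then (if i a = i b then ∏ j, p (i j) else 0) else 0) ≤ k * ∑ x, p x ^ 2 := by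
    intro a
    rw [Finset.sum_comm]
    have h3 : ∀ b : Fin k, ∑ i : Fin k → n,
        (if a ≠ b then (if i a = i b then ∏ j, p (i j) else 0) else 0) ≤ ∑ x, p x ^ 2 := by
      intro b
      by_cases hab : a ≠ b
      · simp only [if_pos hab]
        exact (sum_prod_of_eq_le_sum_sq hp1 hab).le
      · simp only [if_neg hab, Finset.sum_const_zero]
        positivity
    simpa using Finset.sum_le_sum fun b (_ : b ∈ Finset.univ) => h3 b
  have := Finset.sum_le_sum fun a (_ : a ∈ Finset.univ) => h2 a
  simp only [Finset.sum_const, Finset.card_univ, Fintype.card_fin, nsmul_eq_mul] at this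
  calc _ ≤ _ := this
    _ = _ := by ring

variable {n : Type*}

/-- The orthogonal projector `P_S` onto the span of the basis vectors indexed by `S`. -/
def coordProj [DecidableEq n] (S : Finset n) : Matrix n n ℂ :=
  Matrix.diagonal fun s => if s ∈ S then 1 else 0

/-- An operator commuting with the `k`-fold tensor power of a permutation matrix has entries
invariant under that permutation. -/
theorem apply_comp_perm_of_commute [Fintype n] [DecidableEq n] {k : ℕ}
    {W : Matrix (Fin k → n) (Fin k → n) ℂ} {σ : Equiv.Perm n}
    (hW : Commute W (tensorPow k (σ.permMatrix ℂ))) (a b : Fin k → n) :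
    W (σ ∘ a) (σ ∘ b) = W a b := by
  have h : ∀ a b : Fin k → n, tensorPow k (σ.permMatrix ℂ) a b = if σ ∘ a = b then 1 else 0 := by
    intro a b
    simp only [tensorPow, Matrix.of_apply, PEquiv.toMatrix_apply, Equiv.toPEquiv_apply,
      Option.mem_some_iff]
    rw [Finset.prod_ite_zero]
    simp [funext_iff]
  have h' : ∀ a b : Fin k → n, tensorPow k (σ.permMatrix ℂ) a b
      = if a = σ.symm ∘ b then 1 else 0 := by
    intro a b
    rw [h]
    congr 1
    simp only [funext_iff, Function.comp_apply, Equiv.eq_symm_apply]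
  have hl : (W * tensorPow k (σ.permMatrix ℂ)) a (σ ∘ b) = W a b := by
    simp [Matrix.mul_apply, h', ← Function.comp_assoc]
  have hr : (tensorPow k (σ.permMatrix ℂ) * W) a (σ ∘ b) = W (σ ∘ a) (σ ∘ b) := by
    simp [Matrix.mul_apply, h]
  rw [← hl, ← hr, hW.eq]

theorem commute_permMatrix_coordProj [Fintype n] [DecidableEq n] {S : Finset n} {σ : Equiv.Perm n}
    (hσ : ∀ x, σ x ∈ S ↔ x ∈ S) :
    Commute (σ.permMatrix ℂ) (coordProj S) := by
  ext i j
  simp only [coordProj, Matrix.mul_diagonal, Matrix.diagonal_mul, PEquiv.toMatrix_apply,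
    Equiv.toPEquiv_apply, Option.mem_some_iff]
  by_cases h : σ i = j
  · subst h; simp [hσ]
  · simp [h]

theorem exists_perm_comp_eq [DecidableEq n] {k : ℕ} {S : Finset n} {a b : Fin k → n}
    (ha : Function.Injective a)
    (hb : Function.Injective b) (haS : ∀ j, a j ∈ S) (hbS : ∀ j, b j ∈ S) :
    ∃ σ : Equiv.Perm n, (∀ x, σ x ∈ S ↔ x ∈ S) ∧ σ ∘ a = b := by
  obtain ⟨τ, hτ⟩ := Equiv.Perm.exists_smul_eq_embedding (β := {x // x ∈ S})
    ⟨fun j => ⟨a j, haS j⟩, fun i j h => ha (by simpa using h)⟩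
    ⟨fun j => ⟨b j, hbS j⟩, fun i j h => hb (by simpa using h)⟩
  refine ⟨Equiv.Perm.ofSubtype τ, fun x => ?_, ?_⟩
  · exact Equiv.Perm.ofSubtype_apply_mem_iff_mem τ x
  · ext j
    have := congrArg Subtype.val (DFunLike.congr_fun hτ j)
    rw [Function.comp_apply, Equiv.Perm.ofSubtype_apply_of_mem τ (haS j)]
    exact this

/-- A positive semidefinite matrix supported in `S` is diagonalized by a unitary commuting with
`P_S`: the eigenvector matrix of its `S`-block, extended by the identity. -/
theorem exists_diagonalization [Fintype n] [DecidableEq n] {S : Finset n} {ρ : Matrix n n ℂ}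
    (hρ : ρ.PosSemidef) (hS : coordProj S * ρ * coordProj S = ρ) :
    ∃ V ∈ Matrix.unitaryGroup n ℂ, Commute V (coordProj S) ∧ ∃ p : n → ℝ, (∀ x, 0 ≤ p x) ∧
      (∀ x, x ∉ S → p x = 0) ∧
      ρ = V * Matrix.diagonal (fun x => (p x : ℂ)) * V.conjTranspose := by
  let e := Equiv.sumCompl (· ∈ S)
  let ρS : Matrix {x // x ∈ S} {x // x ∈ S} ℂ := ρ.submatrix Subtype.val Subtype.val
  have hρS : ρS.PosSemidef := hρ.submatrix _
  let R := Matrix.reindexAlgEquiv ℂ ℂ e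
  have hRs : ∀ X, (R X).conjTranspose = R X.conjTranspose := fun X =>
    (Matrix.conjTranspose_reindex e e X).symm ▸ rfl
  let U : Matrix {x // x ∈ S} {x // x ∈ S} ℂ := hρS.1.eigenvectorUnitary.1
  let X : Matrix _ _ ℂ := Matrix.fromBlocks U 0 0
    (1 : Matrix {x // ¬ x ∈ S} {x // ¬ x ∈ S} ℂ)
  let q : {x // x ∈ S} ⊕ {x // ¬ x ∈ S} → ℝ := Sum.elim hρS.1.eigenvalues 0
  have hq : ∀ y, 0 ≤ q y := by
    rintro (y | y)
    · exact hρS.eigenvalues_nonneg y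
    · exact le_rfl
  have hP : coordProj S = R (Matrix.fromBlocks 1 0 0 0) := by
    ext i j
    obtain ⟨i, rfl⟩ := e.surjective i
    obtain ⟨j, rfl⟩ := e.surjective j
    rcases i with ⟨i, hi⟩ | ⟨i, hi⟩ <;> rcases j with ⟨j, hj⟩ | ⟨j, hj⟩ <;>
      simp [R, e, coordProj, Matrix.diagonal_apply, Matrix.one_apply, hi, hj]
    exact fun h => absurd (h ▸ hi) hj
  have hρR : ρ = R (Matrix.fromBlocks ρS 0 0 0) := by
    rw [← hS]
    ext i j
    obtain ⟨i, rfl⟩ := e.surjective i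
    obtain ⟨j, rfl⟩ := e.surjective j
    rcases i with ⟨i, hi⟩ | ⟨i, hi⟩ <;> rcases j with ⟨j, hj⟩ | ⟨j, hj⟩ <;>
      simp [R, e, coordProj, hi, hj, ρS]
  refine ⟨R X, ?_, ?_, fun x => q (e.symm x), fun x => ?_, fun x hx => ?_, ?_⟩
  · rw [Matrix.mem_unitaryGroup_iff, Matrix.star_eq_conjTranspose, hRs, ← map_mul,
      Matrix.fromBlocks_conjTranspose, Matrix.fromBlocks_multiply]
    have : U * U.conjTranspose = 1 :=
      Matrix.mem_unitaryGroup_iff.mp hρS.1.eigenvectorUnitary.2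
    simp [this]
  · rw [hP, Commute, SemiconjBy, ← map_mul, ← map_mul, Matrix.fromBlocks_multiply,
      Matrix.fromBlocks_multiply]
    simp
  · exact hq _
  · have : e.symm x = Sum.inr ⟨x, hx⟩ := Equiv.sumCompl_symm_apply_of_neg hx
    simp only [this, q, Sum.elim_inr, Pi.zero_apply]
  · have hd : Matrix.diagonal (fun x => ((q (e.symm x) : ℝ) : ℂ))
        = R (Matrix.fromBlocks (Matrix.diagonal fun i => (hρS.1.eigenvalues i : ℂ)) 0 0 0) := by
      ext i j
      obtain ⟨i, rfl⟩ := e.surjective i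
      obtain ⟨j, rfl⟩ := e.surjective j
      rcases i with i | i <;> rcases j with j | j <;>
        simp [R, q, Matrix.diagonal_apply]
    have hsp : ρS = U * (Matrix.diagonal fun i => (hρS.1.eigenvalues i : ℂ))
        * U.conjTranspose := by
      conv_lhs => rw [hρS.1.spectral_theorem]
      rfl
    rw [hd, hRs, ← map_mul, ← map_mul, Matrix.fromBlocks_conjTranspose, Matrix.fromBlocks_multiply,
      Matrix.fromBlocks_multiply]
    simp only [Matrix.conjTranspose_one, Matrix.conjTranspose_zero, mul_zero, zero_mul, add_zero,
      Matrix.mul_zero, Matrix.zero_mul]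
    rw [← hsp]
    exact hρR

/-- If a unitary `W` commutes with `V^{⊗k}` for every unitary `V` commuting with `P_S`, then on
the `k`-th tensor powers of states supported in `S` the functional `Tr (W ·)` is constant up to an
error controlled by the purity of the state. -/
theorem exists_norm_trace_mul_tensorPow_sub_le [Fintype n] [DecidableEq n] (k : ℕ) (S : Finset n)
    {W : Matrix (Fin k → n) (Fin k → n) ℂ} (hW : W ∈ Matrix.unitaryGroup (Fin k → n) ℂ)
    (hWc : ∀ V ∈ Matrix.unitaryGroup n ℂ, Commute V (coordProj S) → Commute W (tensorPow k V)) :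
    ∃ w : ℂ, ∀ ρ : Matrix n n ℂ, ρ.PosSemidef → ρ.trace = 1 →
      coordProj S * ρ * coordProj S = ρ →
      ‖(W * tensorPow k ρ).trace - w‖ ≤ 2 * (k : ℝ) ^ 2 * (ρ * ρ).trace.re := by
  -- `w` is the common diagonal entry.
  -- If `S` has fewer than `k` elements, any `w` with `‖w‖ ≤ 1` will do.
  have hw : ∃ w : ℂ, ‖w‖ ≤ 1 ∧
      ∀ a : Fin k → n, Function.Injective a → (∀ j, a j ∈ S) → W a a = w := by
    by_cases h : ∃ a : Fin k → n, Function.Injective a ∧ ∀ j, a j ∈ S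
    · obtain ⟨a, ha, haS⟩ := h
      refine ⟨W a a, entry_norm_bound_of_unitary hW a a, fun b hb hbS => ?_⟩
      obtain ⟨σ, hσ, rfl⟩ := exists_perm_comp_eq ha hb haS hbS
      exact apply_comp_perm_of_commute (hWc _ (permMatrix_mem_unitaryGroup σ)
        (commute_permMatrix_coordProj hσ)) a a
    · exact ⟨0, by simp, fun a ha haS => absurd ⟨a, ha, haS⟩ h⟩
  obtain ⟨w, hw1, hw⟩ := hw
  refine ⟨w, fun ρ hρ htr hS => ?_⟩
  obtain ⟨V, hV, hVS, p, hp, hpS, rfl⟩ := exists_diagonalization hρ hS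
  have hVV : V.conjTranspose * V = 1 := Matrix.mem_unitaryGroup_iff'.mp hV
  have hp1 : ∑ x, p x = 1 := by
    rw [Matrix.trace_mul_comm, ← mul_assoc, hVV, one_mul, Matrix.trace_diagonal] at htr
    exact_mod_cast htr
  have hp2 : (V * Matrix.diagonal (fun x => (p x : ℂ)) * V.conjTranspose
      * (V * Matrix.diagonal (fun x => (p x : ℂ)) * V.conjTranspose)).trace.re = ∑ x, p x ^ 2 := by
    have : V * Matrix.diagonal (fun x => (p x : ℂ)) * V.conjTranspose
      * (V * Matrix.diagonal (fun x => (p x : ℂ)) * V.conjTranspose)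
      = V * (Matrix.diagonal (fun x => (p x : ℂ)) * (V.conjTranspose * V)
        * Matrix.diagonal (fun x => (p x : ℂ)) * V.conjTranspose) := by noncomm_ring
    rw [this, hVV, mul_one, Matrix.trace_mul_comm, mul_assoc, hVV, mul_one,
      Matrix.diagonal_mul_diagonal, Matrix.trace_diagonal, Complex.re_sum]
    refine Finset.sum_congr rfl fun x _ => ?_
    rw [← Complex.ofReal_mul, Complex.ofReal_re, sq]
  have htrace : (W * tensorPow k (V * Matrix.diagonal (fun x => (p x : ℂ)) * V.conjTranspose)).trace
      = ∑ a : Fin k → n, W a a * (∏ j, p (a j) : ℝ) := by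
    have h1 : tensorPow k V.conjTranspose * tensorPow k V = 1 := by
      rw [← tensorPow_mul, hVV, tensorPow_one]
    rw [tensorPow_mul, tensorPow_mul, ← mul_assoc, ← mul_assoc, (hWc V hV hVS).eq,
      Matrix.trace_mul_comm, ← mul_assoc, ← mul_assoc, h1, one_mul, tensorPow_diagonal,
      Matrix.trace]
    simp
  have hsum : ∑ a : Fin k → n, ∏ j, p (a j) = 1 := by
    have := Finset.prod_univ_sum (fun _ : Fin k => (Finset.univ : Finset n)) (fun _ y => p y)
    rw [Fintype.piFinset_univ] at this
    rw [← this]; simp [hp1]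
  have hsub : ∑ a : Fin k → n, W a a * (∏ j, p (a j) : ℝ) - w
      = ∑ a : Fin k → n, (W a a - w) * (∏ j, p (a j) : ℝ) := by
    simp only [sub_mul, Finset.sum_sub_distrib]
    rw [← Finset.mul_sum, ← Complex.ofReal_sum, hsum]
    simp
  rw [hp2, htrace, hsub]
  calc ‖∑ a : Fin k → n, (W a a - w) * (∏ j, p (a j) : ℝ)‖
      ≤ ∑ a : Fin k → n, 2 * (if Function.Injective a then 0 else ∏ j, p (a j)) := by
        refine norm_sum_le_of_le _ fun a _ => ?_
        have hnn : 0 ≤ ∏ j, p (a j) := Finset.prod_nonneg fun j _ => hp _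
        rw [norm_mul, Complex.norm_real, Real.norm_of_nonneg hnn]
        by_cases hz : ∀ j, a j ∈ S
        · split_ifs with hinj
          · rw [hw a hinj hz]; simp
          · refine mul_le_mul_of_nonneg_right ?_ hnn
            have := entry_norm_bound_of_unitary hW a a
            linarith [norm_sub_le (W a a) w]
        · push Not at hz
          obtain ⟨j, hj⟩ := hz
          rw [Finset.prod_eq_zero (Finset.mem_univ j) (hpS _ hj)]
          simp
    _ ≤ 2 * (k : ℝ) ^ 2 * ∑ x, p x ^ 2 := by
        rw [← Finset.mul_sum, mul_assoc]
        exact mul_le_mul_of_nonneg_left (sum_prod_not_injective_le k hp hp1) zero_le_two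

end Twirl

/-! ### Second moments of a Haar-random projector -/

section Moments

variable {n : Type*}

instance instIsMulLeftInvariantHaar [Fintype n] [DecidableEq n] :
    (haarUnitary n).IsMulLeftInvariant := by
  unfold haarUnitary; infer_instance

/-- The conjugate `U P U†` of `P` by the unitary `U`. -/
def conjugate [Fintype n] [DecidableEq n] (P : Matrix n n ℂ)
    (U : Matrix.unitaryGroup n ℂ) : Matrix n n ℂ :=
  (U : Matrix n n ℂ) * P * (U : Matrix n n ℂ).conjTranspose

theorem continuous_conjugate [Fintype n] [DecidableEq n] (P : Matrix n n ℂ) :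
    Continuous (conjugate P) := by
  unfold conjugate
  have : Continuous fun U : Matrix.unitaryGroup n ℂ => (U : Matrix n n ℂ) := continuous_subtype_val
  exact (this.mul continuous_const).mul this.matrix_conjTranspose

theorem conjugate_mul [Fintype n] [DecidableEq n] (P : Matrix n n ℂ)
    (V U : Matrix.unitaryGroup n ℂ) :
    conjugate P (V * U)
      = (V : Matrix n n ℂ) * conjugate P U * (V : Matrix n n ℂ).conjTranspose := by
  simp only [conjugate, Submonoid.coe_mul, Matrix.conjTranspose_mul, mul_assoc]

/-- The law of `U P U†` under Haar measure is invariant under unitary conjugation. -/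
theorem integral_conjugate_invariant [Fintype n] [DecidableEq n] (P : Matrix n n ℂ)
    (f : Matrix n n ℂ → ℝ) (V : Matrix.unitaryGroup n ℂ) :
    ∫ U, f ((V : Matrix n n ℂ) * conjugate P U * (V : Matrix n n ℂ).conjTranspose) ∂(haarUnitary n)
      = ∫ U, f (conjugate P U) ∂(haarUnitary n) := by
  simp only [← conjugate_mul]
  exact integral_mul_left_eq_self (fun U => f (conjugate P U)) V

theorem integrable_comp_conjugate [Fintype n] [DecidableEq n] (P : Matrix n n ℂ)
    {f : Matrix n n ℂ → ℝ} (hf : Continuous f) :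
    Integrable (fun U => f (conjugate P U)) (haarUnitary n) :=
  (hf.comp (continuous_conjugate P)).integrable_of_hasCompactSupport
    (HasCompactSupport.of_compactSpace _)

theorem conjTranspose_mul_self_coe [Fintype n] [DecidableEq n] (U : Matrix.unitaryGroup n ℂ) :
    (U : Matrix n n ℂ).conjTranspose * (U : Matrix n n ℂ) = 1 :=
  Matrix.mem_unitaryGroup_iff'.mp U.2

theorem conjugate_isHermitian [Fintype n] [DecidableEq n] {P : Matrix n n ℂ} (hP : P.IsHermitian)
    (U : Matrix.unitaryGroup n ℂ) : (conjugate P U).IsHermitian :=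
  Matrix.isHermitian_mul_mul_conjTranspose _ hP

theorem conjugate_mul_self [Fintype n] [DecidableEq n] {P : Matrix n n ℂ} (hP : IsStarProjection P)
    (U : Matrix.unitaryGroup n ℂ) : conjugate P U * conjugate P U = conjugate P U := by
  have : conjugate P U * conjugate P U = (U : Matrix n n ℂ) * (P *
      ((U : Matrix n n ℂ).conjTranspose * (U : Matrix n n ℂ)) * P)
        * (U : Matrix n n ℂ).conjTranspose := by
    simp only [conjugate, mul_assoc]
  rw [this, conjTranspose_mul_self_coe, mul_one, hP.isIdempotentElem.eq, conjugate]

theorem trace_conjugate [Fintype n] [DecidableEq n] (P : Matrix n n ℂ)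
    (U : Matrix.unitaryGroup n ℂ) : (conjugate P U).trace = P.trace := by
  rw [conjugate, Matrix.trace_mul_comm, ← mul_assoc, conjTranspose_mul_self_coe, one_mul]

theorem diag_eq_sum_sq [Fintype n] {A : Matrix n n ℂ} (hA : A.IsHermitian) (hAA : A * A = A)
    (s : n) :
    A s s = ((∑ t, ‖A s t‖ ^ 2 : ℝ) : ℂ) := by
  conv_lhs => rw [← hAA, Matrix.mul_apply]
  push_cast
  refine Finset.sum_congr rfl fun t _ => ?_
  rw [← hA.apply t s, Complex.star_def, Complex.mul_conj, Complex.normSq_eq_norm_sq]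
  push_cast; rfl

theorem diag_re_eq_sum_sq [Fintype n] {A : Matrix n n ℂ} (hA : A.IsHermitian) (hAA : A * A = A)
    (s : n) : (A s s).re = ∑ t, ‖A s t‖ ^ 2 := by
  rw [diag_eq_sum_sq hA hAA s, Complex.ofReal_re]

theorem ofReal_re_diag {A : Matrix n n ℂ} (hA : A.IsHermitian) (s : n) :
    (((A s s).re : ℝ) : ℂ) = A s s :=
  Complex.conj_eq_iff_re.mp (hA.apply s s)

theorem norm_sq_apply_le [Fintype n] {A : Matrix n n ℂ} (hA : A.IsHermitian) (hAA : A * A = A)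
    (s t : n) :
    ‖A s t‖ ^ 2 ≤ (A s s).re * (A t t).re := by
  rw [diag_re_eq_sum_sq hA hAA s, diag_re_eq_sum_sq hA hAA t]
  have h1 : ‖A s t‖ ≤ ∑ u, ‖A s u‖ * ‖A t u‖ := by
    conv_lhs => rw [← hAA, Matrix.mul_apply]
    refine norm_sum_le_of_le _ fun u _ => ?_
    rw [norm_mul, ← hA.apply u t, norm_star]
  calc ‖A s t‖ ^ 2 ≤ (∑ u, ‖A s u‖ * ‖A t u‖) ^ 2 := by gcongr
    _ ≤ _ := Finset.sum_mul_sq_le_sq_mul_sq _ _ _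

theorem perm_conj_apply [Fintype n] [DecidableEq n] (A : Matrix n n ℂ) (σ : Equiv.Perm n)
    (s t : n) : (σ.permMatrix ℂ * A * (σ.permMatrix ℂ).conjTranspose) s t = A (σ s) (σ t) := by
  rw [Matrix.conjTranspose_permMatrix, PEquiv.toMatrix_toPEquiv_mul, PEquiv.mul_toMatrix_toPEquiv]
  rfl

theorem integral_perm [Fintype n] [DecidableEq n] (P : Matrix n n ℂ) (f : Matrix n n ℂ → ℝ)
    (σ : Equiv.Perm n) :
    ∫ U, f ((conjugate P U).submatrix σ σ) ∂(haarUnitary n)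
      = ∫ U, f (conjugate P U) ∂(haarUnitary n) := by
  have h : ∀ A : Matrix n n ℂ,
      A.submatrix σ σ = σ.permMatrix ℂ * A * (σ.permMatrix ℂ).conjTranspose := fun A => by
    ext s t
    exact (perm_conj_apply A σ s t).symm
  simp only [h]
  exact integral_conjugate_invariant P f ⟨_, permMatrix_mem_unitaryGroup σ⟩

theorem conj_apply_row [Fintype n] (A : Matrix n n ℂ) (V : Matrix n n ℂ) (s : n) :
    (V * A * V.conjTranspose) s s = ∑ i, ∑ j, V s i * A i j * star (V s j) := by
  simp only [Matrix.mul_apply, Matrix.conjTranspose_apply, Finset.sum_mul]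
  exact Finset.sum_comm

/-- For a Haar-random conjugate `A` of `P`, the law of the quadratic form `v A v†` is the same for
all unit vectors `v`; for a basis vector it is a diagonal entry. -/
theorem integral_quadraticForm_eq [Fintype n] [DecidableEq n] (P : Matrix n n ℂ) (f : ℂ → ℝ)
    (s : n) (v : n → ℂ) (hv : ∑ i, ‖v i‖ ^ 2 = 1) :
    ∫ U, f (∑ i, ∑ j, v i * conjugate P U i j * star (v j)) ∂(haarUnitary n)
      = ∫ U, f (conjugate P U s s) ∂(haarUnitary n) := by
  obtain ⟨V, hV⟩ := exists_unitary_row s v hv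
  rw [← integral_conjugate_invariant P (fun A => f (A s s)) V]
  simp only [conj_apply_row, hV]

theorem integral_diag [Fintype n] [DecidableEq n] {P : Matrix n n ℂ} (s : n) :
    ∫ U, (conjugate P U s s).re ∂(haarUnitary n) = P.trace.re / Fintype.card n := by
  have hsym : ∀ t, ∫ U, (conjugate P U t t).re ∂(haarUnitary n)
      = ∫ U, (conjugate P U s s).re ∂(haarUnitary n) := fun t => by
    simpa using integral_perm P (fun A => (A s s).re) (Equiv.swap s t)
  have hsum : ∑ t, ∫ U, (conjugate P U t t).re ∂(haarUnitary n) = P.trace.re := by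
    rw [← integral_finsetSum _ fun t _ => integrable_comp_conjugate P
      (f := fun A => (A t t).re) (by fun_prop)]
    have : ∀ U, ∑ t, (conjugate P U t t).re = P.trace.re := fun U => by
      rw [← trace_conjugate P U, Matrix.trace, Complex.re_sum]; rfl
    simp [this]
  rw [Finset.sum_congr rfl fun t _ => hsym t, Finset.sum_const, nsmul_eq_mul,
    Finset.card_univ] at hsum
  have : (Fintype.card n : ℝ) ≠ 0 := by
    have : Nonempty n := ⟨s⟩
    exact_mod_cast Fintype.card_ne_zero
  field_simp
  linarith

/-- The consequence of unitary invariance that permutations alone do not give; it follows by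
comparing the quadratic form of `A` at `e_s` with its values at `(e_s + ω e_t) / √2`. -/
theorem integral_sq_diag_relation [Fintype n] [DecidableEq n] {P : Matrix n n ℂ}
    (hP : P.IsHermitian) {s t : n} (hst : s ≠ t) :
    ∫ U, (conjugate P U s s).re ^ 2 ∂(haarUnitary n)
      = ∫ U, ‖conjugate P U s t‖ ^ 2 ∂(haarUnitary n)
        + ∫ U, (conjugate P U s s).re * (conjugate P U t t).re ∂(haarUnitary n) := by
  have hsym : ∫ U, (conjugate P U t t).re ^ 2 ∂(haarUnitary n)
      = ∫ U, (conjugate P U s s).re ^ 2 ∂(haarUnitary n) := by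
    simpa using integral_perm P (fun A => (A s s).re ^ 2) (Equiv.swap s t)
  let g : ℂ → Matrix n n ℂ → ℝ := fun ω A =>
    (((A s s).re + (A t t).re + 2 * (star ω * A s t).re) / 2) ^ 2
  -- `g ω` is the squared quadratic form at the row vector `(e_s + ω e_t) / √2`.
  have hω : ∀ ω : ℂ, ‖ω‖ = 1 → ∫ U, g ω (conjugate P U) ∂(haarUnitary n)
      = ∫ U, (conjugate P U s s).re ^ 2 ∂(haarUnitary n) := by
    intro ω h1
    let c : ℂ := ((√2)⁻¹ : ℝ)
    have hc : c * star c = 1 / 2 := by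
      rw [Complex.star_def, Complex.conj_ofReal, ← Complex.ofReal_mul, ← mul_inv,
        Real.mul_self_sqrt zero_le_two]
      norm_num
    have hcn : ‖c‖ ^ 2 = 1 / 2 := by
      rw [Complex.norm_real, Real.norm_eq_abs, sq_abs, inv_pow, Real.sq_sqrt zero_le_two]
      norm_num
    let v : n → ℂ := fun i => if i = s then c else if i = t then c * ω else 0
    have hsplit : ∀ {M : Type} [AddCommMonoid M] (F : n → M), (∀ i, i ≠ s → i ≠ t → F i = 0) →
        ∑ i, F i = F s + F t := by
      intro M _ F hF
      rw [← Finset.sum_pair hst]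
      refine (Finset.sum_subset (Finset.subset_univ _) fun i _ hi => ?_).symm
      simp only [Finset.mem_insert, Finset.mem_singleton, not_or] at hi
      exact hF i hi.1 hi.2
    have hvs : v s = c := if_pos rfl
    have hvt : v t = c * ω := by simp [v, hst.symm]
    have hv0 : ∀ i, i ≠ s → i ≠ t → v i = 0 := fun i h1 h2 => by simp [v, h1, h2]
    have hv : ∑ i, ‖v i‖ ^ 2 = 1 := by
      rw [hsplit _ fun i h1 h2 => by simp [hv0 i h1 h2], hvs, hvt, norm_mul, h1, mul_one, hcn]
      norm_num
    rw [← integral_quadraticForm_eq P (fun z => z.re ^ 2) s v hv]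
    congr! 2 with U
    set A := conjugate P U
    have hA : A.IsHermitian := conjugate_isHermitian hP U
    have hωω : ω * star ω = 1 := by
      rw [Complex.star_def, Complex.mul_conj, Complex.normSq_eq_norm_sq, h1]; norm_num
    have hval : ∑ i, ∑ j, v i * A i j * star (v j)
        = (1 / 2) * (A s s + A t t + (star ω * A s t + star (star ω * A s t))) := by
      rw [hsplit _ fun i h1 h2 => by simp [hv0 i h1 h2],
        hsplit _ fun i h1 h2 => by simp [hv0 i h1 h2],
        hsplit _ fun i h1 h2 => by simp [hv0 i h1 h2], hvs, hvt, star_mul', star_mul', star_star,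
        hA.apply t s]
      linear_combination (A s s + A s t * star ω + ω * A t s + ω * star ω * A t t) * hc
        + 1 / 2 * A t t * hωω
    have hhalf : ∀ z : ℂ, ((1 / 2 : ℂ) * z).re = z.re / 2 := fun z => by
      rw [show (1 / 2 : ℂ) = ((1 / 2 : ℝ) : ℂ) by norm_num, Complex.re_ofReal_mul]; ring
    rw [hval, hhalf]
    simp only [g, Complex.add_re, Complex.star_def, Complex.conj_re]
    ring
  have hg : ∀ ω, Integrable (fun U => g ω (conjugate P U)) (haarUnitary n) := fun ω =>
    integrable_comp_conjugate P (by fun_prop)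
  -- Averaging over the phases `1, -1, i, -i` removes the terms linear and quadratic in the phase.
  have hpt : ∀ A : Matrix n n ℂ, g 1 A + g (-1) A + (g Complex.I A + g (-Complex.I) A)
      = (A s s).re ^ 2 + (A t t).re ^ 2 + (2 * ((A s s).re * (A t t).re) + 2 * ‖A s t‖ ^ 2) := by
    intro A
    rw [← Complex.normSq_eq_norm_sq, Complex.normSq_apply]
    simp [g]
    ring
  have h4 : ∫ U, (g 1 (conjugate P U) + g (-1) (conjugate P U)
      + (g Complex.I (conjugate P U) + g (-Complex.I) (conjugate P U))) ∂(haarUnitary n)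
      = 4 * ∫ U, (conjugate P U s s).re ^ 2 ∂(haarUnitary n) := by
    have h12 : Integrable (fun U => g 1 (conjugate P U) + g (-1) (conjugate P U))
        (haarUnitary n) := (hg 1).add (hg (-1))
    have h34 : Integrable (fun U => g Complex.I (conjugate P U) + g (-Complex.I) (conjugate P U))
        (haarUnitary n) := (hg Complex.I).add (hg (-Complex.I))
    rw [integral_add h12 h34, integral_add (hg _) (hg _),
      integral_add (hg _) (hg _), hω 1 (by simp), hω (-1) (by simp), hω Complex.I (by simp),
      hω (-Complex.I) (by simp)]
    ring
  have i1 := integrable_comp_conjugate P (f := fun A => (A s s).re ^ 2) (by fun_prop)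
  have i2 := integrable_comp_conjugate P (f := fun A => (A t t).re ^ 2) (by fun_prop)
  have i3 := integrable_comp_conjugate P (f := fun A => 2 * ((A s s).re * (A t t).re)) (by fun_prop)
  have i4 := integrable_comp_conjugate P (f := fun A => 2 * ‖A s t‖ ^ 2) (by fun_prop)
  have i12 : Integrable (fun U => (conjugate P U s s).re ^ 2 + (conjugate P U t t).re ^ 2)
      (haarUnitary n) := i1.add i2
  have i34 : Integrable (fun U => 2 * ((conjugate P U s s).re * (conjugate P U t t).re)
      + 2 * ‖conjugate P U s t‖ ^ 2) (haarUnitary n) := i3.add i4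
  simp only [hpt] at h4
  rw [integral_add i12 i34, integral_add i1 i2, integral_add i3 i4,
    integral_const_mul, integral_const_mul, hsym] at h4
  linarith

/-- The moments `β = E |A_st|²` and `γ = E A_ss A_tt` for `s ≠ t`, with `A = U P U†` and `P` of
rank `r`. In dimension `d ≥ 2` they are `β = c (d - r)` and `γ = c (r d - 1)` with
`c = r / (d (d² - 1))`. In dimension one there are no such pairs, and `β = 0`, `γ = 1` serve. -/
theorem exists_second_moments [Fintype n] [DecidableEq n] {P : Matrix n n ℂ}
    (hP : IsStarProjection P) (hr : 1 ≤ P.rank) :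
    ∃ β γ : ℝ, 0 ≤ β ∧ β ≤ P.rank / (Fintype.card n : ℝ) ^ 2 ∧
      γ ≤ (P.rank : ℝ) ^ 2 / (Fintype.card n : ℝ) ^ 2 ∧
      (∀ s, ∫ U, (conjugate P U s s).re ^ 2 ∂(haarUnitary n) = β + γ) ∧
      ∀ s t, s ≠ t → ∫ U, ‖conjugate P U s t‖ ^ 2 ∂(haarUnitary n) = β ∧
        ∫ U, (conjugate P U s s).re * (conjugate P U t t).re ∂(haarUnitary n) = γ := by
  have hH : P.IsHermitian := hP.isSelfAdjoint
  have hrd : P.rank ≤ Fintype.card n := P.rank_le_card_width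
  have hn : Nonempty n := Fintype.card_pos_iff.mp (hr.trans hrd)
  obtain ⟨s₀⟩ := hn
  have hα : ∀ s, ∫ U, (conjugate P U s s).re ^ 2 ∂(haarUnitary n)
      = ∫ U, (conjugate P U s₀ s₀).re ^ 2 ∂(haarUnitary n) := fun s => by
    simpa using integral_perm P (fun A => (A s₀ s₀).re ^ 2) (Equiv.swap s₀ s)
  have hsumsq : ∑ s, ∑ t, ∫ U, ‖conjugate P U s t‖ ^ 2 ∂(haarUnitary n) = P.rank := by
    have hi : ∀ s t, Integrable (fun U => ‖conjugate P U s t‖ ^ 2) (haarUnitary n) := fun s t =>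
      integrable_comp_conjugate P (f := fun A => ‖A s t‖ ^ 2) (by fun_prop)
    simp only [← integral_finsetSum _ fun t _ => hi _ t]
    rw [← integral_finsetSum _ fun s _ => integrable_finsetSum _ fun t _ => hi s t]
    have : ∀ U, ∑ s, ∑ t, ‖conjugate P U s t‖ ^ 2 = P.rank := fun U => by
      simp only [← diag_re_eq_sum_sq (conjugate_isHermitian hH U) (conjugate_mul_self hP U)]
      have := trace_conjugate P U
      rw [trace_eq_rank_of_isStarProjection hP] at this
      simpa [Matrix.trace] using congrArg Complex.re this
    simp [this]
  have hsumdiag : ∑ s, ∑ t, ∫ U, (conjugate P U s s).re * (conjugate P U t t).re ∂(haarUnitary n)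
      = (P.rank : ℝ) ^ 2 := by
    have hi : ∀ s t, Integrable (fun U => (conjugate P U s s).re * (conjugate P U t t).re)
        (haarUnitary n) := fun s t =>
      integrable_comp_conjugate P (f := fun A => (A s s).re * (A t t).re) (by fun_prop)
    simp only [← integral_finsetSum _ fun t _ => hi _ t]
    rw [← integral_finsetSum _ fun s _ => integrable_finsetSum _ fun t _ => hi s t]
    have : ∀ U, ∑ s, ∑ t, (conjugate P U s s).re * (conjugate P U t t).re
        = (P.rank : ℝ) ^ 2 := fun U => by
      rw [← Finset.sum_mul_sum]
      have := trace_conjugate P U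
      rw [trace_eq_rank_of_isStarProjection hP] at this
      have : ∑ s, (conjugate P U s s).re = P.rank := by
        simpa [Matrix.trace] using congrArg Complex.re this
      rw [this, sq]
    simp [this]
  have hdiag2 : ∀ s, ∫ U, ‖conjugate P U s s‖ ^ 2 ∂(haarUnitary n)
      = ∫ U, (conjugate P U s₀ s₀).re ^ 2 ∂(haarUnitary n) := fun s => by
    rw [← hα s]
    congr! 2 with U
    rw [← ofReal_re_diag (conjugate_isHermitian hH U) s, Complex.norm_real, Complex.ofReal_re,
      Real.norm_eq_abs, sq_abs]
  set α := ∫ U, (conjugate P U s₀ s₀).re ^ 2 ∂(haarUnitary n)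
  have hr' : (1 : ℝ) ≤ P.rank := by exact_mod_cast hr
  have hrd' : (P.rank : ℝ) ≤ Fintype.card n := by exact_mod_cast hrd
  -- In dimension one the off-diagonal moments are vacuous, and `α = 1` as `P` is the identity.
  by_cases hcard : Fintype.card n = 1
  · have hsub : Subsingleton n := Fintype.card_le_one_iff_subsingleton.mp hcard.le
    have hr1 : P.rank = 1 := le_antisymm (hcard ▸ hrd) hr
    have huniv : (Finset.univ : Finset n) = {s₀} := by
      ext i; simp [Subsingleton.elim i s₀]
    rw [huniv] at hsumsq
    simp only [Finset.sum_singleton, hdiag2, hr1] at hsumsq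
    refine ⟨0, 1, le_rfl, by positivity, by simp [hcard, hr1], fun s => by simp [hα, hsumsq],
      fun s t hst => absurd (Subsingleton.elim s t) hst⟩
  have hcard2 : 1 < Fintype.card n := by
    have := Fintype.card_pos_iff.mpr ⟨s₀⟩
    omega
  obtain ⟨t₀, ht₀⟩ := Fintype.exists_ne_of_one_lt_card hcard2 s₀
  have hperm : ∀ s t, s ≠ t → ∃ σ : Equiv.Perm n, σ s₀ = s ∧ σ t₀ = t := by
    intro s t hst
    refine ⟨Equiv.swap s₀ s * Equiv.swap t₀ (Equiv.swap s₀ s t), ?_, ?_⟩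
    · rw [Equiv.Perm.mul_apply, Equiv.swap_apply_of_ne_of_ne ht₀.symm, Equiv.swap_apply_left]
      intro h
      have := congrArg (Equiv.swap s₀ s) h
      rw [Equiv.swap_apply_left, Equiv.swap_apply_self] at this
      exact hst this
    · rw [Equiv.Perm.mul_apply, Equiv.swap_apply_left, Equiv.swap_apply_self]
  set β := ∫ U, ‖conjugate P U s₀ t₀‖ ^ 2 ∂(haarUnitary n)
  set γ := ∫ U, (conjugate P U s₀ s₀).re * (conjugate P U t₀ t₀).re ∂(haarUnitary n)
  have hrel : α = β + γ := integral_sq_diag_relation hH ht₀.symm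
  have hβ : ∀ s t, s ≠ t → ∫ U, ‖conjugate P U s t‖ ^ 2 ∂(haarUnitary n) = β := by
    intro s t hst
    obtain ⟨σ, rfl, rfl⟩ := hperm s t hst
    exact integral_perm P (fun A => ‖A s₀ t₀‖ ^ 2) σ
  have hγ : ∀ s t, s ≠ t →
      ∫ U, (conjugate P U s s).re * (conjugate P U t t).re ∂(haarUnitary n) = γ := by
    intro s t hst
    obtain ⟨σ, rfl, rfl⟩ := hperm s t hst
    exact integral_perm P (fun A => (A s₀ s₀).re * (A t₀ t₀).re) σ
  have hsum : ∀ (F : n → n → ℝ) (x y : ℝ), (∀ s, F s s = x) → (∀ s t, s ≠ t → F s t = y) →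
      ∑ s, ∑ t, F s t = Fintype.card n * (x + (Fintype.card n - 1) * y) := by
    intro F x y hx hy
    have : ∀ s, ∑ t, F s t = x + (Fintype.card n - 1) * y := by
      intro s
      rw [← Finset.add_sum_erase _ _ (Finset.mem_univ s), hx,
        Finset.sum_congr rfl fun t ht => hy s t (Finset.ne_of_mem_erase ht).symm,
        Finset.sum_const, nsmul_eq_mul, Finset.card_erase_of_mem (Finset.mem_univ s),
        Finset.card_univ, Nat.cast_sub hcard2.le, Nat.cast_one]
    simp only [this, Finset.sum_const, Finset.card_univ, nsmul_eq_mul]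
  rw [hsum _ α β hdiag2 hβ] at hsumsq
  rw [hsum _ α γ (fun s => by rw [← hα s]; simp only [sq]) hγ] at hsumdiag
  have hd : (2 : ℝ) ≤ Fintype.card n := by exact_mod_cast hcard2
  generalize (Fintype.card n : ℝ) = d at *
  generalize (P.rank : ℝ) = r at *
  have hd0 : 0 < d := by linarith
  have hk : 0 < d * (d ^ 2 - 1) := mul_pos hd0 (by nlinarith)
  -- The two sum rules and the relation `α = β + γ` form a linear system for the moments.
  have hβv : β * (d * (d ^ 2 - 1)) = r * (d - r) := by
    linear_combination (-(1:ℝ)) * hsumdiag + d * hsumsq - d * (d - 1) * hrel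
  have hγv : γ * (d * (d ^ 2 - 1)) = r * (r * d - 1) := by
    linear_combination (-(1:ℝ)) * hsumsq + d * hsumdiag - d * (d - 1) * hrel
  refine ⟨β, γ, integral_nonneg fun U => by positivity, ?_, ?_, fun s => (hα s).trans hrel,
    fun s t hst => ⟨hβ s t hst, hγ s t hst⟩⟩
  · rw [le_div_iff₀ (by positivity)]
    refine le_of_mul_le_mul_right ?_ hk
    have : β * d ^ 2 * (d * (d ^ 2 - 1)) = r * d * (d * (d - r)) := by linear_combination d^2 * hβv
    rw [this]
    have h2 : d * (d - r) ≤ d ^ 2 - 1 := by nlinarith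
    calc r * d * (d * (d - r)) ≤ r * d * (d ^ 2 - 1) := by gcongr
      _ = _ := by ring
  · rw [le_div_iff₀ (by positivity)]
    refine le_of_mul_le_mul_right ?_ hk
    have : γ * d ^ 2 * (d * (d ^ 2 - 1)) = r * d * (d * (r * d - 1)) := by
      linear_combination d^2 * hγv
    rw [this]
    have h2 : d * (r * d - 1) ≤ r * (d ^ 2 - 1) := by nlinarith
    calc r * d * (d * (r * d - 1)) ≤ r * d * (r * (d ^ 2 - 1)) := by gcongr
      _ = _ := by ring

end Moments

/-! ### Concentration of the sector weight and the mean purity -/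

section Concentration

variable {n : Type*}

/-- The quadratic form of an orthogonal projector `A` is `‖A v‖²`, so it vanishes only on the
kernel. The vector is conjugated because `v` is a row vector here. -/
theorem mulVec_eq_zero_of_quadraticForm_eq_zero [Fintype n] {A : Matrix n n ℂ} (hA : A.IsHermitian)
    (hAA : A * A = A) {v : n → ℂ} (hv : ∑ i, ∑ j, v i * A i j * star (v j) = 0) :
    A.mulVec (star v) = 0 := by
  have h1 : dotProduct v (A.mulVec (star v)) = 0 := by
    rw [← hv]
    simp [dotProduct, Matrix.mulVec, Finset.mul_sum, mul_assoc]
  have h2 : dotProduct (star (A.mulVec (star v))) (A.mulVec (star v)) = 0 := by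
    rw [Matrix.star_mulVec, hA.eq, star_star, Matrix.dotProduct_mulVec, Matrix.vecMul_vecMul, hAA,
      ← Matrix.dotProduct_mulVec, h1]
  open scoped ComplexOrder in exact dotProduct_star_self_eq_zero.mp h2

/-- A nonzero matrix annihilates at most `d` of the points `(1, t, t², …)` of the moment curve: an
entry of the image is a polynomial in `t` of degree less than `d`. -/
theorem card_filter_momentCurve_le [Fintype n] [DecidableEq n] {A : Matrix n n ℂ} (hA : A ≠ 0)
    (e : n ≃ Fin (Fintype.card n)) (M : ℕ) :
    ((Finset.range M).filter fun t : ℕ => A.mulVec (fun i => (t : ℂ) ^ (e i : ℕ)) = 0).card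
      ≤ Fintype.card n := by
  obtain ⟨i₀, j₀, h0⟩ : ∃ i j, A i j ≠ 0 := by
    by_contra! h
    exact hA (Matrix.ext h)
  let q : Polynomial ℂ := ∑ j, Polynomial.monomial (e j : ℕ) (A i₀ j)
  have hq : q ≠ 0 := by
    intro h
    have h1 : q.coeff (e j₀ : ℕ) = A i₀ j₀ := by
      simp only [q, Polynomial.finsetSum_coeff, Polynomial.coeff_monomial, Fin.val_inj,
        e.injective.eq_iff]
      simp
    rw [h, Polynomial.coeff_zero] at h1
    exact h0 h1.symm
  have hdeg : q.natDegree ≤ Fintype.card n :=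
    Polynomial.natDegree_sum_le_of_forall_le _ _ fun j _ =>
      (Polynomial.natDegree_monomial_le _).trans (e j).2.le
  have hmaps : ∀ t ∈ (Finset.range M).filter
      fun t : ℕ => A.mulVec (fun i => (t : ℂ) ^ (e i : ℕ)) = 0, (t : ℂ) ∈ q.roots.toFinset := by
    intro t ht
    have := congrFun (Finset.mem_filter.mp ht).2 i₀
    rw [Multiset.mem_toFinset, Polynomial.mem_roots hq, Polynomial.IsRoot]
    simpa [q, Polynomial.eval_finsetSum, Matrix.mulVec, dotProduct] using this
  calc _ ≤ q.roots.toFinset.card :=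
        Finset.card_le_card_of_injOn (fun t : ℕ => (t : ℂ)) hmaps (Nat.cast_injective.injOn)
    _ ≤ q.roots.card := Multiset.toFinset_card_le _
    _ ≤ q.natDegree := Polynomial.card_roots' q
    _ ≤ _ := hdeg

/-- All the events `v A v† = 0`, for unit vectors `v`, have the probability `q` of `A_ss = 0`. At
most `d` of those with `v` on the moment curve occur together, so `M q ≤ d` for every `M`. -/
theorem ae_conjugate_diag_ne_zero [Fintype n] [DecidableEq n] {P : Matrix n n ℂ}
    (hP : IsStarProjection P) (hr : 1 ≤ P.rank)
    (s : n) : ∀ᵐ U ∂(haarUnitary n), conjugate P U s s ≠ 0 := by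
  classical
  let e := Fintype.equivFin n
  let f : ℂ → ℝ := fun z => if z = 0 then 1 else 0
  have hfm : Measurable f := Measurable.ite (measurableSet_singleton 0) measurable_const
    measurable_const
  have hH : P.IsHermitian := hP.isSelfAdjoint
  let c : ℕ → ℝ := fun t => (√(∑ i, (((t : ℝ)) ^ (e i : ℕ)) ^ 2))⁻¹
  have hpos : ∀ t : ℕ, 0 < ∑ i, (((t : ℝ)) ^ (e i : ℕ)) ^ 2 := by
    intro t
    refine Finset.sum_pos' (fun i _ => by positivity)
      ⟨e.symm ⟨0, Fintype.card_pos_iff.mpr ⟨s⟩⟩, Finset.mem_univ _, by simp⟩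
  let v : ℕ → n → ℂ := fun t i => ((c t * (t : ℝ) ^ (e i : ℕ) : ℝ) : ℂ)
  have hv : ∀ t, ∑ i, ‖v t i‖ ^ 2 = 1 := by
    intro t
    have : ∀ i, ‖v t i‖ ^ 2 = c t ^ 2 * ((t : ℝ) ^ (e i : ℕ)) ^ 2 := fun i => by
      rw [Complex.norm_real, Real.norm_eq_abs, sq_abs, mul_pow]
    rw [Finset.sum_congr rfl fun i _ => this i, ← Finset.mul_sum, inv_pow,
      Real.sq_sqrt (hpos t).le, inv_mul_cancel₀ (hpos t).ne']
  have hzero : ∀ t U, ∑ i, ∑ j, v t i * conjugate P U i j * star (v t j) = 0 →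
      (conjugate P U).mulVec (fun i => (t : ℂ) ^ (e i : ℕ)) = 0 := by
    intro t U h
    have h1 := mulVec_eq_zero_of_quadraticForm_eq_zero (conjugate_isHermitian hH U)
      (conjugate_mul_self hP U) h
    have h2 : star (v t) = (c t : ℂ) • fun i => (t : ℂ) ^ (e i : ℕ) := by
      ext i
      simp [v]
    rw [h2, Matrix.mulVec_smul, smul_eq_zero] at h1
    refine h1.resolve_left ?_
    exact Complex.ofReal_ne_zero.mpr (inv_ne_zero (Real.sqrt_ne_zero'.mpr (hpos t)))
  have hcont : ∀ i j, Continuous fun U => conjugate P U i j := fun i j =>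
    (continuous_id.matrix_elem i j).comp (continuous_conjugate P)
  have hqm : ∀ t, Measurable fun U => f (∑ i, ∑ j, v t i * conjugate P U i j * star (v t j)) := by
    intro t
    refine hfm.comp (Continuous.measurable ?_)
    exact continuous_finsetSum _ fun i _ => continuous_finsetSum _ fun j _ =>
      (continuous_const.mul (hcont i j)).mul continuous_const
  have hqi : ∀ t, Integrable
      (fun U => f (∑ i, ∑ j, v t i * conjugate P U i j * star (v t j))) (haarUnitary n) := by
    intro t
    refine Integrable.of_bound (hqm t).aestronglyMeasurable 1 (Filter.Eventually.of_forall
      fun U => ?_)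
    simp only [f]; split_ifs <;> simp
  set q := ∫ U, f (conjugate P U s s) ∂(haarUnitary n) with hq
  have hbound : ∀ M : ℕ, M * q ≤ Fintype.card n := by
    intro M
    have h1 : (M : ℝ) * q = ∫ U, ∑ t ∈ Finset.range M,
        f (∑ i, ∑ j, v t i * conjugate P U i j * star (v t j)) ∂(haarUnitary n) := by
      rw [integral_finsetSum _ fun t _ => hqi t,
        Finset.sum_congr rfl fun t _ => integral_quadraticForm_eq P f s (v t) (hv t)]
      simp [hq]
    rw [h1]
    have h2 : ∀ U, ∑ t ∈ Finset.range M,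
        f (∑ i, ∑ j, v t i * conjugate P U i j * star (v t j)) ≤ Fintype.card n := by
      intro U
      have hne : conjugate P U ≠ 0 := by
        intro h
        have := trace_conjugate P U
        rw [h, Matrix.trace_zero, trace_eq_rank_of_isStarProjection hP] at this
        have h0 : P.rank = 0 := by exact_mod_cast this.symm
        omega
      simp only [f]
      rw [← Finset.sum_filter, Finset.sum_const, nsmul_eq_mul, mul_one]
      exact_mod_cast (Finset.card_le_card (Finset.monotone_filter_right _
        fun t _ h => hzero t U h)).trans (card_filter_momentCurve_le hne e M)
    calc _ ≤ ∫ U, (Fintype.card n : ℝ) ∂(haarUnitary n) :=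
          integral_mono (integrable_finsetSum _ fun t _ => hqi t) (integrable_const _) h2
      _ = _ := by simp
  have hf0 : ∀ z, 0 ≤ f z := fun z => by simp only [f]; split_ifs <;> simp
  have hq0 : q = 0 := by
    refine le_antisymm ?_ (integral_nonneg fun U => hf0 _)
    by_contra! hlt
    obtain ⟨M, hM⟩ := exists_nat_gt (Fintype.card n / q)
    rw [div_lt_iff₀ hlt] at hM
    exact (hbound M).not_gt hM
  have hfi : Integrable (fun U => f (conjugate P U s s)) (haarUnitary n) := by
    refine Integrable.of_bound (hfm.comp (hcont s s).measurable).aestronglyMeasurable 1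
      (Filter.Eventually.of_forall fun U => ?_)
    simp only [f]; split_ifs <;> simp
  rw [hq, integral_eq_zero_iff_of_nonneg (fun U => hf0 _) hfi] at hq0
  filter_upwards [hq0] with U hU h
  simp [f, h] at hU

/-- The weight `∑_{s ∈ S} A_ss` of `A` in the sector `S`, which is the trace of `P_S A P_S` for
Hermitian `A`. -/
noncomputable def sectorWeight (S : Finset n) (A : Matrix n n ℂ) : ℝ := ∑ s ∈ S, (A s s).re

/-- The squared Frobenius norm of the `S`-block of `A`, which is the trace of `(P_S A P_S)²` for
Hermitian `A`. -/
noncomputable def blockNormSq (S : Finset n) (A : Matrix n n ℂ) : ℝ := ∑ s ∈ S, ∑ t ∈ S, ‖A s t‖ ^ 2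

theorem continuous_sectorWeight (S : Finset n) : Continuous (sectorWeight S) := by
  unfold sectorWeight; fun_prop

theorem continuous_blockNormSq (S : Finset n) : Continuous (blockNormSq S) := by
  unfold blockNormSq; fun_prop

theorem blockNormSq_nonneg (S : Finset n) (A : Matrix n n ℂ) : 0 ≤ blockNormSq S A :=
  Finset.sum_nonneg fun _ _ => Finset.sum_nonneg fun _ _ => by positivity

theorem sum_sum_eq_diag_add_offDiag [DecidableEq n] {S : Finset n} {F : n → n → ℝ} {x y : ℝ}
    (hx : ∀ s, F s s = x) (hy : ∀ s t, s ≠ t → F s t = y) :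
    ∑ s ∈ S, ∑ t ∈ S, F s t = S.card * (x + (S.card - 1) * y) := by
  have : ∀ s ∈ S, ∑ t ∈ S, F s t = x + (S.card - 1) * y := by
    intro s hs
    rw [← Finset.add_sum_erase _ _ hs, hx,
      Finset.sum_congr rfl fun t ht => hy s t (Finset.ne_of_mem_erase ht).symm,
      Finset.sum_const, nsmul_eq_mul, Finset.card_erase_of_mem hs,
      Nat.cast_sub (Finset.card_pos.mpr ⟨s, hs⟩), Nat.cast_one]
  rw [Finset.sum_congr rfl this, Finset.sum_const, nsmul_eq_mul]

/-- The variance of the sector weight and the mean squared Frobenius norm of the block, for a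
Haar-random conjugate of the projector `P`. -/
theorem sector_moments_le [Fintype n] [DecidableEq n] {P : Matrix n n ℂ} (hP : IsStarProjection P)
    (hr : 1 ≤ P.rank) (S : Finset n) :
    ∫ U, (sectorWeight S (conjugate P U) - S.card * P.rank / Fintype.card n) ^ 2 ∂(haarUnitary n)
        ≤ S.card * P.rank / (Fintype.card n : ℝ) ^ 2 ∧
      ∫ U, blockNormSq S (conjugate P U) ∂(haarUnitary n)
        ≤ S.card * P.rank * (S.card + P.rank) / (Fintype.card n : ℝ) ^ 2 := by
  have hH : P.IsHermitian := hP.isSelfAdjoint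
  obtain ⟨β, γ, hβ0, hβ, hγ, hα, hβγ⟩ := exists_second_moments hP hr
  have hiw := integrable_comp_conjugate P (continuous_sectorWeight S)
  have hiw2 := integrable_comp_conjugate P (f := fun A => sectorWeight S A ^ 2)
    ((continuous_sectorWeight S).pow 2)
  have hT : ∫ U, sectorWeight S (conjugate P U) ∂(haarUnitary n)
      = S.card * P.rank / Fintype.card n := by
    simp only [sectorWeight]
    rw [integral_finsetSum _ fun t _ => integrable_comp_conjugate P
      (f := fun A => (A t t).re) (by fun_prop)]
    simp only [integral_diag, trace_eq_rank_of_isStarProjection hP, Complex.natCast_re,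
      Finset.sum_const, nsmul_eq_mul]
    ring
  have hT2 : ∫ U, sectorWeight S (conjugate P U) ^ 2 ∂(haarUnitary n)
      = S.card * (β + γ + (S.card - 1) * γ) := by
    have hi : ∀ s t, Integrable (fun U => (conjugate P U s s).re * (conjugate P U t t).re)
        (haarUnitary n) := fun s t =>
      integrable_comp_conjugate P (f := fun A => (A s s).re * (A t t).re) (by fun_prop)
    simp only [sectorWeight, sq, Finset.sum_mul_sum]
    rw [integral_finsetSum _ fun s _ => integrable_finsetSum _ fun t _ => hi s t]
    simp only [integral_finsetSum _ fun t _ => hi _ t]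
    exact sum_sum_eq_diag_add_offDiag (fun s => by rw [← hα s]; simp only [sq])
      fun s t hst => (hβγ s t hst).2
  have hF : ∫ U, blockNormSq S (conjugate P U) ∂(haarUnitary n)
      = S.card * (β + γ + (S.card - 1) * β) := by
    have hi : ∀ s t, Integrable (fun U => ‖conjugate P U s t‖ ^ 2) (haarUnitary n) := fun s t =>
      integrable_comp_conjugate P (f := fun A => ‖A s t‖ ^ 2) (by fun_prop)
    simp only [blockNormSq]
    rw [integral_finsetSum _ fun s _ => integrable_finsetSum _ fun t _ => hi s t]
    simp only [integral_finsetSum _ fun t _ => hi _ t]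
    refine sum_sum_eq_diag_add_offDiag (fun s => ?_) fun s t hst => (hβγ s t hst).1
    rw [← hα s]
    congr! 2 with U
    rw [← ofReal_re_diag (conjugate_isHermitian hH U) s, Complex.norm_real, Complex.ofReal_re,
      Real.norm_eq_abs, sq_abs]
  have hm : (0 : ℝ) ≤ S.card := Nat.cast_nonneg _
  have hd : (0 : ℝ) < Fintype.card n := by
    exact_mod_cast (hr.trans P.rank_le_card_width)
  constructor
  · have hexp : ∀ U, (sectorWeight S (conjugate P U) - S.card * P.rank / Fintype.card n) ^ 2
        = sectorWeight S (conjugate P U) ^ 2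
          - 2 * (S.card * P.rank / Fintype.card n) * sectorWeight S (conjugate P U)
          + (S.card * P.rank / Fintype.card n : ℝ) ^ 2 := fun U => by ring
    have hsub : Integrable (fun U => sectorWeight S (conjugate P U) ^ 2
          - 2 * (S.card * P.rank / Fintype.card n) * sectorWeight S (conjugate P U))
          (haarUnitary n) := hiw2.sub (hiw.const_mul _)
    simp only [hexp]
    rw [integral_add hsub (integrable_const _), integral_sub hiw2 (hiw.const_mul _),
      integral_const_mul, hT, hT2]
    simp only [integral_const, probReal_univ, one_smul]
    calc _ = S.card * β + (S.card : ℝ) ^ 2 * (γ - (P.rank : ℝ) ^ 2 / (Fintype.card n : ℝ) ^ 2) := by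
          ring
      _ ≤ S.card * (P.rank / (Fintype.card n : ℝ) ^ 2) + (S.card : ℝ) ^ 2 * 0 := by
          gcongr
          linarith
      _ = _ := by ring
  · rw [hF]
    calc _ = (S.card : ℝ) ^ 2 * β + S.card * γ := by ring
      _ ≤ (S.card : ℝ) ^ 2 * (P.rank / (Fintype.card n : ℝ) ^ 2)
          + S.card * ((P.rank : ℝ) ^ 2 / (Fintype.card n : ℝ) ^ 2) := by gcongr
      _ = _ := by ring

theorem blockNormSq_le_sq [Fintype n] {A : Matrix n n ℂ} (hA : A.IsHermitian) (hAA : A * A = A)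
    (S : Finset n) : blockNormSq S A ≤ sectorWeight S A ^ 2 := by
  rw [sectorWeight, sq, Finset.sum_mul_sum]
  exact Finset.sum_le_sum fun s _ => Finset.sum_le_sum fun t _ => norm_sq_apply_le hA hAA s t

/-- The first summand bounds the purity when the weight is at least `μ / 2`; otherwise the second
is at least `1`, and the purity is at most `1`. -/
theorem purity_le_add [Fintype n] {A : Matrix n n ℂ} (hA : A.IsHermitian) (hAA : A * A = A)
    (S : Finset n) {μ : ℝ} (hμ : 0 < μ) :
    blockNormSq S A / sectorWeight S A ^ 2
      ≤ 4 / μ ^ 2 * blockNormSq S A + 4 / μ ^ 2 * (sectorWeight S A - μ) ^ 2 := by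
  have hF := blockNormSq_nonneg S A
  have hle := blockNormSq_le_sq hA hAA S
  set F := blockNormSq S A
  set T := sectorWeight S A
  by_cases hT : μ / 2 ≤ T
  · have h1 : F / T ^ 2 ≤ F / (μ / 2) ^ 2 := by gcongr
    have h2 : 0 ≤ 4 / μ ^ 2 * (T - μ) ^ 2 := by positivity
    calc F / T ^ 2 ≤ F / (μ / 2) ^ 2 := h1
      _ = 4 / μ ^ 2 * F := by field_simp; norm_num
      _ ≤ _ := by linarith
  · have h1 : F / T ^ 2 ≤ 1 := div_le_one_of_le₀ hle (sq_nonneg T)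
    have h2 : 0 ≤ 4 / μ ^ 2 * F := by positivity
    have h3 : (μ / 2) ^ 2 ≤ (T - μ) ^ 2 := by
      push Not at hT
      nlinarith
    have h4 : 1 ≤ 4 / μ ^ 2 * (T - μ) ^ 2 := by
      calc (1 : ℝ) = 4 / μ ^ 2 * (μ / 2) ^ 2 := by field_simp; norm_num
        _ ≤ _ := by gcongr
    linarith

theorem integrable_purity [Fintype n] [DecidableEq n] {P : Matrix n n ℂ} (hP : IsStarProjection P)
    (S : Finset n) :
    Integrable (fun U => blockNormSq S (conjugate P U) / sectorWeight S (conjugate P U) ^ 2)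
      (haarUnitary n) := by
  have hc := continuous_conjugate P
  refine Integrable.of_bound (Measurable.aestronglyMeasurable ?_) 1
    (Filter.Eventually.of_forall fun U => ?_)
  · exact ((continuous_blockNormSq S).comp hc).measurable.div
      (((continuous_sectorWeight S).comp hc).pow 2).measurable
  · rw [Real.norm_of_nonneg (div_nonneg (blockNormSq_nonneg _ _) (sq_nonneg _))]
    exact div_le_one_of_le₀ (blockNormSq_le_sq (conjugate_isHermitian hP.isSelfAdjoint U)
      (conjugate_mul_self hP U) S) (sq_nonneg _)

theorem chebyshev_constant_le {m r d : ℝ} (hr : 1 ≤ r) (hm : r ≤ m) (hd : 0 < d) :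
    4 / (m * r / d) ^ 2 * (m * r * (m + r) / d ^ 2) + 4 / (m * r / d) ^ 2 * (m * r / d ^ 2)
      ≤ 12 / r := by
  have hr0 : 0 < r := by linarith
  have hm0 : 0 < m := by linarith
  have h : 4 / (m * r / d) ^ 2 * (m * r * (m + r) / d ^ 2)
      + 4 / (m * r / d) ^ 2 * (m * r / d ^ 2) = 4 * (m + r + 1) / (m * r) := by
    field_simp
  rw [h, div_le_div_iff₀ (by positivity) hr0]
  nlinarith

theorem integral_purity_le [Fintype n] [DecidableEq n] {P : Matrix n n ℂ} (hP : IsStarProjection P)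
    (hr : 1 ≤ P.rank) {S : Finset n} (hS : P.rank ≤ S.card) :
    ∫ U, blockNormSq S (conjugate P U) / sectorWeight S (conjugate P U) ^ 2 ∂(haarUnitary n)
      ≤ 12 / P.rank := by
  obtain ⟨h1, h2⟩ := sector_moments_le hP hr S
  have hd : (0 : ℝ) < Fintype.card n := by
    exact_mod_cast (hr.trans P.rank_le_card_width)
  have hr0 : (1 : ℝ) ≤ P.rank := by exact_mod_cast hr
  have hm : (P.rank : ℝ) ≤ S.card := by exact_mod_cast hS
  have hm0 : (0 : ℝ) < S.card := by linarith
  refine le_trans ?_ (chebyshev_constant_le hr0 hm hd)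
  -- `μ` is the mean of the sector weight.
  have hμ : (0 : ℝ) < S.card * P.rank / Fintype.card n := by positivity
  generalize (S.card * P.rank / Fintype.card n : ℝ) = μ at *
  have hc1 : Continuous fun A : Matrix n n ℂ => 4 / μ ^ 2 * blockNormSq S A :=
    continuous_const.mul (continuous_blockNormSq S)
  have hc2 : Continuous fun A : Matrix n n ℂ => 4 / μ ^ 2 * (sectorWeight S A - μ) ^ 2 :=
    continuous_const.mul (((continuous_sectorWeight S).sub continuous_const).pow 2)
  have hi1 := integrable_comp_conjugate P hc1
  have hi2 := integrable_comp_conjugate P hc2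
  have hmono : ∫ U, blockNormSq S (conjugate P U) / sectorWeight S (conjugate P U) ^ 2
        ∂(haarUnitary n)
      ≤ ∫ U, (4 / μ ^ 2 * blockNormSq S (conjugate P U)
        + 4 / μ ^ 2 * (sectorWeight S (conjugate P U) - μ) ^ 2) ∂(haarUnitary n) :=
    integral_mono (integrable_purity hP S) (hi1.add hi2) fun U =>
      purity_le_add (conjugate_isHermitian hP.isSelfAdjoint U) (conjugate_mul_self hP U) S hμ
  rw [integral_add hi1 hi2, integral_const_mul, integral_const_mul] at hmono
  have hc : 0 ≤ 4 / μ ^ 2 := by positivity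
  exact hmono.trans (add_le_add (mul_le_mul_of_nonneg_left h2 hc)
    (mul_le_mul_of_nonneg_left h1 hc))

end Concentration

/-! ### The average of the copies -/

section Copies

open scoped ComplexOrder

variable {n : Type*}

/-- The compression `P_S A P_S`. -/
def compression [Fintype n] [DecidableEq n] (S : Finset n) (A : Matrix n n ℂ) : Matrix n n ℂ :=
  coordProj S * A * coordProj S

/-- The compression `P_S A P_S` divided by its trace; it is zero if this trace vanishes. -/
noncomputable def normalizedCompression [Fintype n] [DecidableEq n] (S : Finset n)
    (A : Matrix n n ℂ) : Matrix n n ℂ :=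
  (compression S A).trace⁻¹ • compression S A

theorem compression_apply [Fintype n] [DecidableEq n] (S : Finset n) (A : Matrix n n ℂ) (s t : n) :
    compression S A s t = if s ∈ S ∧ t ∈ S then A s t else 0 := by
  simp only [compression, coordProj, Matrix.mul_diagonal, Matrix.diagonal_mul]
  by_cases hs : s ∈ S <;> by_cases ht : t ∈ S <;> simp [hs, ht]

theorem coordProj_isHermitian [DecidableEq n] (S : Finset n) : (coordProj S).IsHermitian := by
  refine Matrix.isHermitian_diagonal_of_self_adjoint _ (funext fun s => ?_)
  by_cases h : s ∈ S <;> simp [h]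

theorem coordProj_mul_self [Fintype n] [DecidableEq n]
    (S : Finset n) : coordProj S * coordProj S = coordProj S := by
  simp [coordProj, Matrix.diagonal_mul_diagonal]

theorem trace_coordProj [Fintype n] [DecidableEq n] (S : Finset n) :
    (coordProj S).trace = S.card := by
  simp [coordProj, Matrix.trace_diagonal]

theorem trace_compression [Fintype n] [DecidableEq n] {A : Matrix n n ℂ} (hA : A.IsHermitian)
    (S : Finset n) : (compression S A).trace = (sectorWeight S A : ℂ) := by
  simp only [Matrix.trace, Matrix.diag_apply, compression_apply, and_self, sectorWeight,
    Complex.ofReal_sum, ofReal_re_diag hA]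
  simp

theorem trace_compression_sq [Fintype n] [DecidableEq n] {A : Matrix n n ℂ} (hA : A.IsHermitian)
    (S : Finset n) : (compression S A * compression S A).trace = (blockNormSq S A : ℂ) := by
  simp only [Matrix.trace, Matrix.diag_apply, Matrix.mul_apply, compression_apply, blockNormSq,
    Complex.ofReal_sum]
  rw [← Finset.sum_subset (Finset.subset_univ S) fun s _ hs => by simp [hs]]
  refine Finset.sum_congr rfl fun s hs => ?_
  rw [← Finset.sum_subset (Finset.subset_univ S) fun t _ ht => by simp [ht]]
  refine Finset.sum_congr rfl fun t ht => ?_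
  rw [if_pos ⟨hs, ht⟩, if_pos ⟨ht, hs⟩, ← hA.apply t s, Complex.star_def, Complex.mul_conj,
    Complex.normSq_eq_norm_sq]

theorem normalizedCompression_isHermitian [Fintype n] [DecidableEq n] {A : Matrix n n ℂ}
    (hA : A.IsHermitian) (S : Finset n) : (normalizedCompression S A).IsHermitian := by
  rw [normalizedCompression, Matrix.IsHermitian, Matrix.conjTranspose_smul, trace_compression hA]
  congr 1
  · simp
  · simp only [compression, Matrix.conjTranspose_mul, (coordProj_isHermitian S).eq, hA.eq,
      mul_assoc]

theorem normalizedCompression_posSemidef [Fintype n] [DecidableEq n] {A : Matrix n n ℂ}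
    (hA : A.PosSemidef) (S : Finset n) : (normalizedCompression S A).PosSemidef := by
  have h : (compression S A).PosSemidef := by
    have := hA.mul_mul_conjTranspose_same (coordProj S)
    rwa [(coordProj_isHermitian S).eq] at this
  have ht := h.trace_nonneg
  rw [normalizedCompression]
  refine h.smul ?_
  rw [trace_compression hA.1] at ht ⊢
  rw [← Complex.ofReal_inv]
  exact Complex.zero_le_real.mpr (inv_nonneg.mpr (Complex.zero_le_real.mp ht))

theorem normalizedCompression_supported [Fintype n] [DecidableEq n] (S : Finset n)
    (A : Matrix n n ℂ) :
    coordProj S * normalizedCompression S A * coordProj S = normalizedCompression S A := by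
  have h : coordProj S * compression S A * coordProj S = compression S A := by
    calc _ = (coordProj S * coordProj S) * A * (coordProj S * coordProj S) := by
          simp only [compression, mul_assoc]
      _ = _ := by rw [coordProj_mul_self, compression]
  rw [normalizedCompression, Matrix.mul_smul, Matrix.smul_mul, h]

theorem purity_normalizedCompression [Fintype n] [DecidableEq n] {A : Matrix n n ℂ}
    (hA : A.IsHermitian) (S : Finset n) :
    (normalizedCompression S A * normalizedCompression S A).trace.re
      = blockNormSq S A / sectorWeight S A ^ 2 := by
  rw [normalizedCompression, Matrix.smul_mul, Matrix.mul_smul, Matrix.trace_smul, Matrix.trace_smul,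
    trace_compression hA, trace_compression_sq hA, smul_eq_mul, smul_eq_mul, ← Complex.ofReal_inv,
    ← Complex.ofReal_mul, ← Complex.ofReal_mul, Complex.ofReal_re]
  ring

theorem norm_normalizedCompression_apply_le [Fintype n] [DecidableEq n] {A : Matrix n n ℂ}
    (hA : A.IsHermitian)
    (hAA : A * A = A) (S : Finset n) (s t : n) : ‖normalizedCompression S A s t‖ ≤ 1 := by
  rw [normalizedCompression, Matrix.smul_apply, compression_apply, trace_compression hA]
  split_ifs with h
  · have h1 : ‖A s t‖ ^ 2 ≤ blockNormSq S A := by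
      refine (Finset.single_le_sum (f := fun t => ‖A s t‖ ^ 2) (fun _ _ => by positivity) h.2).trans
        (Finset.single_le_sum (f := fun s => ∑ t ∈ S, ‖A s t‖ ^ 2)
          (fun _ _ => Finset.sum_nonneg fun _ _ => by positivity) h.1)
    have h2 : ‖A s t‖ ≤ |sectorWeight S A| :=
      abs_le_of_sq_le_sq' (by rw [sq_abs]; exact h1.trans (blockNormSq_le_sq hA hAA S))
        (abs_nonneg _) |>.2
    rw [norm_smul, norm_inv, Complex.norm_real, Real.norm_eq_abs, ← div_eq_inv_mul]
    exact div_le_one_of_le₀ h2 (abs_nonneg _)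
  · simp

theorem normalizedCompression_conj [Fintype n] [DecidableEq n] {S : Finset n} {V : Matrix n n ℂ}
    (hV : V ∈ Matrix.unitaryGroup n ℂ) (hVS : Commute V (coordProj S)) (A : Matrix n n ℂ) :
    normalizedCompression S (V * A * V.conjTranspose)
      = V * normalizedCompression S A * V.conjTranspose := by
  have hVS' : V.conjTranspose * coordProj S = coordProj S * V.conjTranspose := by
    have := congrArg Matrix.conjTranspose hVS.eq
    rw [Matrix.conjTranspose_mul, Matrix.conjTranspose_mul, (coordProj_isHermitian S).eq] at this
    exact this.symm
  have h : compression S (V * A * V.conjTranspose) = V * compression S A * V.conjTranspose := by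
    calc _ = (coordProj S * V) * A * (V.conjTranspose * coordProj S) := by
          simp only [compression, mul_assoc]
      _ = _ := by rw [← hVS.eq, hVS']; simp only [compression, mul_assoc]
  have htr : (V * compression S A * V.conjTranspose).trace = (compression S A).trace := by
    have hVV : V.conjTranspose * V = 1 := Matrix.mem_unitaryGroup_iff'.mp hV
    rw [Matrix.trace_mul_comm, ← mul_assoc, hVV, one_mul]
  rw [normalizedCompression, h, htr, normalizedCompression, Matrix.mul_smul, Matrix.smul_mul]

/-- Multiplication by constant matrices commutes with the entrywise integral. -/
theorem integral_mul_mul_apply {Ω m : Type*} [Fintype m] [MeasurableSpace Ω] {μ : Measure Ω}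
    {X : Ω → Matrix m m ℂ} (hX : ∀ a b, Integrable (fun ω => X ω a b) μ) (Y Z : Matrix m m ℂ)
    (a b : m) :
    Integrable (fun ω => (Y * X ω * Z) a b) μ ∧
    (Y * (Matrix.of fun a b => ∫ ω, X ω a b ∂μ) * Z) a b = ∫ ω, (Y * X ω * Z) a b ∂μ := by
  simp only [Matrix.mul_apply, Matrix.of_apply]
  have h1 : ∀ c d, Integrable (fun ω => Y a c * X ω c d) μ := fun c d => (hX c d).const_mul _
  have h2 : ∀ d, Integrable (fun ω => (∑ c, Y a c * X ω c d) * Z d b) μ := fun d =>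
    (integrable_finsetSum _ fun c _ => h1 c d).mul_const _
  refine ⟨integrable_finsetSum _ fun d _ => h2 d, ?_⟩
  rw [integral_finsetSum _ fun d _ => h2 d]
  refine Finset.sum_congr rfl fun d _ => ?_
  rw [integral_mul_const, integral_finsetSum _ fun c _ => h1 c d]
  simp only [integral_const_mul]

theorem integral_trace_mul {Ω m : Type*} [Fintype m] [DecidableEq m] [MeasurableSpace Ω]
    {μ : Measure Ω} {X : Ω → Matrix m m ℂ} (hX : ∀ a b, Integrable (fun ω => X ω a b) μ)
    (W : Matrix m m ℂ) :
    Integrable (fun ω => (W * X ω).trace) μ ∧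
    (W * (Matrix.of fun a b => ∫ ω, X ω a b ∂μ)).trace = ∫ ω, (W * X ω).trace ∂μ := by
  have h := fun a => integral_mul_mul_apply hX W 1 a a
  simp only [mul_one] at h
  simp only [Matrix.trace, Matrix.diag_apply]
  refine ⟨integrable_finsetSum _ fun a _ => (h a).1, ?_⟩
  rw [integral_finsetSum _ fun a _ => (h a).1]
  exact Finset.sum_congr rfl fun a _ => (h a).2

theorem measurable_normalizedCompression_apply [Fintype n] [DecidableEq n] (P : Matrix n n ℂ)
    (S : Finset n) (s t : n) :
    Measurable fun U => normalizedCompression S (conjugate P U) s t := by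
  have hc : Continuous fun U => compression S (conjugate P U) :=
    (continuous_const.mul (continuous_conjugate P)).mul continuous_const
  exact (hc.matrix_trace.measurable.inv).mul (hc.matrix_elem s t).measurable

theorem integrable_copies [Fintype n] [DecidableEq n] {P : Matrix n n ℂ} (hP : IsStarProjection P)
    (S : Finset n) (k : ℕ) (a b : Fin k → n) :
    Integrable (fun U => tensorPow k (normalizedCompression S (conjugate P U)) a b)
      (haarUnitary n) := by
  refine Integrable.of_bound (Measurable.aestronglyMeasurable ?_) 1
    (Filter.Eventually.of_forall fun U => ?_)
  · change Measurable fun U => ∏ j, normalizedCompression S (conjugate P U) (a j) (b j)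
    exact Finset.measurable_prod _ fun j _ => measurable_normalizedCompression_apply P S _ _
  · simp only [tensorPow, Matrix.of_apply, norm_prod]
    exact Finset.prod_le_one (fun _ _ => norm_nonneg _) fun j _ =>
      norm_normalizedCompression_apply_le (conjugate_isHermitian hP.isSelfAdjoint U)
        (conjugate_mul_self hP U) S _ _

theorem conjugate_posSemidef [Fintype n] [DecidableEq n] {P : Matrix n n ℂ}
    (hP : IsStarProjection P) (U : Matrix.unitaryGroup n ℂ) : (conjugate P U).PosSemidef := by
  have h := Matrix.posSemidef_conjTranspose_mul_self (conjugate P U)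
  rwa [(conjugate_isHermitian hP.isSelfAdjoint U).eq, conjugate_mul_self hP U] at h

theorem ae_trace_compression_ne_zero [Fintype n] [DecidableEq n] {P : Matrix n n ℂ}
    (hP : IsStarProjection P) (hr : 1 ≤ P.rank) {S : Finset n} (hS : S.Nonempty) :
    ∀ᵐ U ∂(haarUnitary n), (compression S (conjugate P U)).trace ≠ 0 := by
  obtain ⟨s, hs⟩ := hS
  filter_upwards [ae_conjugate_diag_ne_zero hP hr s] with U hU h
  have hH := conjugate_isHermitian (hP.isSelfAdjoint : P.IsHermitian) U
  rw [trace_compression hH, Complex.ofReal_eq_zero, sectorWeight,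
    Finset.sum_eq_zero_iff_of_nonneg fun t _ => by
      rw [diag_re_eq_sum_sq hH (conjugate_mul_self hP U)]; positivity] at h
  apply hU
  rw [← ofReal_re_diag hH, h s hs, Complex.ofReal_zero]

/-- The average of the copies inherits from Haar measure the invariance under unitaries that
commute with the projector of the sector. -/
theorem commute_tensorPow_average [Fintype n] [DecidableEq n] {P : Matrix n n ℂ}
    (hP : IsStarProjection P) (S : Finset n)
    (k : ℕ) {V : Matrix n n ℂ} (hV : V ∈ Matrix.unitaryGroup n ℂ) (hVS : Commute V (coordProj S)) :
    Commute (Matrix.of fun a b =>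
      ∫ U, tensorPow k (normalizedCompression S (conjugate P U)) a b ∂(haarUnitary n))
      (tensorPow k V) := by
  have hV1 : V.conjTranspose * V = 1 := Matrix.mem_unitaryGroup_iff'.mp hV
  have hVV : tensorPow k V.conjTranspose * tensorPow k V = 1 := by
    rw [← tensorPow_mul, hV1, tensorPow_one]
  set L : Matrix (Fin k → n) (Fin k → n) ℂ := Matrix.of fun a b =>
      ∫ U, tensorPow k (normalizedCompression S (conjugate P U)) a b ∂(haarUnitary n) with hL
  have hinv : tensorPow k V * L * tensorPow k V.conjTranspose = L := by
    ext a b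
    rw [hL, (integral_mul_mul_apply (integrable_copies hP S k) _ _ a b).2]
    simp only [← tensorPow_mul, ← normalizedCompression_conj hV hVS]
    have h : ∀ U, V * conjugate P U * V.conjTranspose
        = conjugate P ((⟨V, hV⟩ : Matrix.unitaryGroup n ℂ) * U) := fun U =>
      (conjugate_mul P ⟨V, hV⟩ U).symm
    simp only [h]
    exact integral_mul_left_eq_self
      (fun U => tensorPow k (normalizedCompression S (conjugate P U)) a b) _
  calc L * tensorPow k V
      = tensorPow k V * L * (tensorPow k V.conjTranspose * tensorPow k V) := by
        rw [← mul_assoc, hinv]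
    _ = tensorPow k V * L := by rw [hVV, mul_one]

theorem coordProj_posSemidef [Fintype n] [DecidableEq n] (S : Finset n) :
    (coordProj S).PosSemidef := by
  have h := Matrix.posSemidef_conjTranspose_mul_self (coordProj S)
  rwa [(coordProj_isHermitian S).eq, coordProj_mul_self] at h

theorem tensorPow_isHermitian {A : Matrix n n ℂ} (hA : A.IsHermitian) (k : ℕ) :
    (tensorPow k A).IsHermitian := by
  rw [Matrix.IsHermitian, ← tensorPow_conjTranspose, hA.eq]

/-- The trace-norm bound for an arbitrary coordinate subspace in place of a charge sector. -/
theorem traceNorm_average_sub_le [Fintype n] [DecidableEq n] {P : Matrix n n ℂ}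
    (hP : IsStarProjection P) (hr : 1 ≤ P.rank) {S : Finset n} (hS : P.rank ≤ S.card) (k : ℕ) :
    traceNorm ((Matrix.of fun a b =>
        ∫ U, tensorPow k (normalizedCompression S (conjugate P U)) a b ∂(haarUnitary n))
        - tensorPow k ((S.card : ℂ)⁻¹ • coordProj S))
      ≤ 26 * ((k : ℝ) ^ 2 / P.rank) := by
  have hm : (0 : ℝ) < S.card := by exact_mod_cast hr.trans hS
  have hr0 : (0 : ℝ) < P.rank := by exact_mod_cast hr
  have hmC : (S.card : ℂ) ≠ 0 := by exact_mod_cast hm.ne'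
  set X : Matrix.unitaryGroup n ℂ → Matrix (Fin k → n) (Fin k → n) ℂ := fun U =>
    tensorPow k (normalizedCompression S (conjugate P U)) with hX
  set ρ₀ : Matrix n n ℂ := (S.card : ℂ)⁻¹ • coordProj S with hρ₀
  set L : Matrix (Fin k → n) (Fin k → n) ℂ := Matrix.of fun a b =>
    ∫ U, X U a b ∂(haarUnitary n) with hL
  have hXi : ∀ a b, Integrable (fun U => X U a b) (haarUnitary n) := integrable_copies hP S k
  have hρ₀psd : ρ₀.PosSemidef := (coordProj_posSemidef S).smul (by
    rw [← Complex.ofReal_natCast, ← Complex.ofReal_inv]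
    exact Complex.zero_le_real.mpr (inv_nonneg.mpr hm.le))
  have hLH : L.IsHermitian := by
    ext a b
    have hXH : ∀ U, star (X U b a) = X U a b := fun U =>
      (tensorPow_isHermitian (normalizedCompression_isHermitian
        (conjugate_isHermitian hP.isSelfAdjoint U) S) k).apply a b
    rw [Matrix.conjTranspose_apply, hL, Matrix.of_apply, Matrix.of_apply, Complex.star_def,
      ← integral_conj]
    exact integral_congr_ae (Filter.Eventually.of_forall hXH)
  obtain ⟨W, hW, hWc, hWt⟩ := exists_unitary_traceNorm_eq
    (hLH.sub (tensorPow_isHermitian hρ₀psd.1 k))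
  obtain ⟨w, hw⟩ := exists_norm_trace_mul_tensorPow_sub_le k S hW fun V hV hVS => by
    refine hWc _ ((commute_tensorPow_average hP S k hV hVS).sub_left ?_)
    have h : ρ₀ * V = V * ρ₀ := by
      rw [hρ₀, Matrix.smul_mul, Matrix.mul_smul, hVS.eq]
    rw [Commute, SemiconjBy, ← tensorPow_mul, ← tensorPow_mul, h]
  have h0 : ‖(W * tensorPow k ρ₀).trace - w‖ ≤ 2 * (k : ℝ) ^ 2 * (1 / S.card) := by
    have htr : ρ₀.trace = 1 := by
      rw [hρ₀, Matrix.trace_smul, trace_coordProj, smul_eq_mul, inv_mul_cancel₀ hmC]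
    have hsup : coordProj S * ρ₀ * coordProj S = ρ₀ := by
      rw [hρ₀, Matrix.mul_smul, Matrix.smul_mul, coordProj_mul_self, coordProj_mul_self]
    have hpur : (ρ₀ * ρ₀).trace.re = 1 / S.card := by
      rw [hρ₀, Matrix.mul_smul, Matrix.smul_mul, coordProj_mul_self, ← hρ₀, Matrix.trace_smul, htr,
        smul_eq_mul, mul_one, ← Complex.ofReal_natCast, ← Complex.ofReal_inv, Complex.ofReal_re,
        one_div]
    exact hpur ▸ hw ρ₀ hρ₀psd htr hsup
  have hU : ∀ᵐ U ∂(haarUnitary n), ‖(W * X U).trace - w‖ ≤ 2 * (k : ℝ) ^ 2 *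
      (blockNormSq S (conjugate P U) / sectorWeight S (conjugate P U) ^ 2) := by
    filter_upwards [ae_trace_compression_ne_zero hP hr (Finset.card_pos.mp (hr.trans hS))]
      with U hne
    rw [← purity_normalizedCompression (conjugate_isHermitian hP.isSelfAdjoint U)]
    refine hw _ (normalizedCompression_posSemidef (conjugate_posSemidef hP U) S) ?_
      (normalizedCompression_supported S _)
    rw [normalizedCompression, Matrix.trace_smul, smul_eq_mul, inv_mul_cancel₀ hne]
  have hint : ‖(W * L).trace - w‖ ≤ 2 * (k : ℝ) ^ 2 * (12 / P.rank) := by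
    have h1 : (W * L).trace - w = ∫ U, ((W * X U).trace - w) ∂(haarUnitary n) := by
      rw [integral_sub (integral_trace_mul hXi W).1 (integrable_const _),
        ← (integral_trace_mul hXi W).2]
      simp [hL]
    rw [h1]
    refine (norm_integral_le_of_norm_le ((integrable_purity hP S).const_mul _) hU).trans ?_
    rw [integral_const_mul]
    exact mul_le_mul_of_nonneg_left (integral_purity_le hP hr hS) (by positivity)
  have hnorm : traceNorm (L - tensorPow k ρ₀)
      ≤ ‖((W * L).trace - w) - ((W * tensorPow k ρ₀).trace - w)‖ := by
    rw [sub_sub_sub_cancel_right, ← Matrix.trace_sub, ← mul_sub, ← hWt, Complex.norm_real]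
    exact le_abs_self _
  have hmr : (1 : ℝ) / S.card ≤ 1 / P.rank :=
    one_div_le_one_div_of_le hr0 (by exact_mod_cast hS)
  calc traceNorm (L - tensorPow k ρ₀) ≤ _ := hnorm
    _ ≤ _ := norm_sub_le _ _
    _ ≤ 2 * (k : ℝ) ^ 2 * (12 / P.rank) + 2 * (k : ℝ) ^ 2 * (1 / P.rank) :=
        add_le_add hint (h0.trans (mul_le_mul_of_nonneg_left hmr (by positivity)))
    _ = _ := by ring

end Copies

/-! ### Charge sectors of qubits -/

/-- The basis states of charge `Q`. -/
def sector (N Q : ℕ) : Finset (Basis N) := Finset.univ.filter fun s => charge s = Q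

theorem chargeProj_eq_coordProj (N Q : ℕ) : chargeProj N Q = coordProj (sector N Q) := by
  simp [chargeProj, coordProj, sector]

/-- Bit strings of charge `Q` correspond to the `Q`-element sets of positions of their ones. -/
theorem card_sector (N Q : ℕ) : (sector N Q).card = sectorDim N Q := by
  have h : sectorDim N Q = (Finset.powersetCard Q (Finset.univ : Finset (Fin N))).card := by
    simp [sectorDim]
  have hcharge : ∀ s : Basis N, charge s = (Finset.univ.filter fun i => s i = 1).card := by
    intro s
    rw [Finset.card_filter, charge]
    refine Finset.sum_congr rfl fun i _ => ?_
    rcases Fin.exists_fin_two.mp ⟨s i, rfl⟩ with h | h <;> simp [h]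
  rw [h]
  refine Finset.card_nbij' (fun s => Finset.univ.filter fun i => s i = 1)
    (fun T i => if i ∈ T then 1 else 0) ?_ ?_ ?_ ?_
  · intro s hs
    simp only [sector, Finset.coe_filter, Set.mem_ofPred_eq, Finset.mem_univ, true_and] at hs
    simp [Finset.mem_powersetCard, ← hcharge, hs]
  · intro T hT
    simp only [Finset.mem_coe, Finset.mem_powersetCard, Finset.subset_univ, true_and] at hT
    simp [sector, hcharge, hT]
  · intro s _
    ext i
    rcases Fin.exists_fin_two.mp ⟨s i, rfl⟩ with h | h <;> simp [h]
  · intro T _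
    ext i
    simp

theorem projectedOp_eq_compression {N : ℕ} (Q : ℕ) (P : Matrix (Basis N) (Basis N) ℂ)
    (U : Matrix.unitaryGroup (Basis N) ℂ) :
    projectedOp Q P U = compression (sector N Q) (conjugate P U) := by
  simp only [projectedOp, compression, conjugate, chargeProj_eq_coordProj, mul_assoc]

theorem projectedState_eq_normalizedCompression {N : ℕ} (Q : ℕ) (P : Matrix (Basis N) (Basis N) ℂ)
    (U : Matrix.unitaryGroup (Basis N) ℂ) :
    projectedState Q P U = normalizedCompression (sector N Q) (conjugate P U) := by
  rw [projectedState, projectedOp_eq_compression, normalizedCompression]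

end HaarCharge

theorem mainTheorem4 :
    ∃ C : ℝ, ∀ (N Q r k : ℕ), 1 ≤ r → r ≤ HaarCharge.sectorDim N Q →
      ∀ P : Matrix (HaarCharge.Basis N) (HaarCharge.Basis N) ℂ,
        IsStarProjection P → P.rank = r →
          (∀ᵐ U ∂(HaarCharge.haarUnitary (HaarCharge.Basis N)),
            (HaarCharge.projectedOp Q P U).trace ≠ 0) ∧
          (∀ a b : Fin k → HaarCharge.Basis N,
            Integrable
              (fun U => HaarCharge.tensorPow k (HaarCharge.projectedState Q P U) a b)
              (HaarCharge.haarUnitary (HaarCharge.Basis N))) ∧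
          HaarCharge.traceNorm
              (HaarCharge.averagedCopies Q P k
                - HaarCharge.tensorPow k (HaarCharge.sectorState N Q))
            ≤ C * ((k : ℝ) ^ 2 / (r : ℝ)) := by
  refine ⟨26, fun N Q r k hr hrd P hP hPr => ?_⟩
  subst hPr
  rw [← HaarCharge.card_sector] at hrd
  simp only [HaarCharge.averagedCopies, HaarCharge.projectedOp_eq_compression,
    HaarCharge.projectedState_eq_normalizedCompression, HaarCharge.sectorState,
    HaarCharge.chargeProj_eq_coordProj, ← HaarCharge.card_sector]
  exact ⟨HaarCharge.ae_trace_compression_ne_zero hP hr (Finset.card_pos.mp (hr.trans hrd)),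
    HaarCharge.integrable_copies hP _ k, HaarCharge.traceNorm_average_sub_le hP hr hrd k⟩
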